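/- Let $L$ be a first-order language, $T$ a complete NIP theory in $L$ (every uniformly definable family of definable sets in a model of $T$ has finite Vapnik–Chervonenkis dimension), and let $M \models T$ be an arbitrary model. Let $G$ be a group definable in $M$ over a set of parameters $A \subseteq M$ (that is, both the underlying set $G(M)\subseteq M^n$ and the graph of multiplication are defined by $L$-formulas with parameters from $A$; for instance, the underlying set of $G(M)$ may be $M$ itself). A set $X \subseteq M^n$ is *externally definable* if $X = Y \cap M^n$ for some elementary extension $N \succeq M$ and some set $Y \subseteq N^n$ definable in $N$ by an $L$-formula with parameters from $N$. Let $M^{\mathrm{ext}}$ (Shelah's expansion) be the expansion of $M$ by a predicate for every externally definable subset of $M^k$, for all $k$, and let $L^{\mathrm{ext}}$ be its language. For a structure $N$ in a language $L'$, a definable group $G(N)$ and a set $B\subseteq N$, let $G^0_{L',B}(N)$ be the intersection of all finite-index subgroups of $G(N)$ that are $L'$-definable in $N$ with parameters from $B$. Then: 1. Every externally definable subgroup of $G(M)$ of finite index is definable in $M$ (by an $L$-formula with parameters from $M$). 2. $G^0(M) = G^0(M^{\mathrm{ext}})$: for all $B, B' \subseteq M$ with $A \subseteq B$ one has $G^0_{L,B}(M)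 = G^0_{L^{\mathrm{ext}},B'}(M)$. 3. The same holds in every elementary extension $\widetilde M \succeq M^{\mathrm{ext}}$ in the language $L^{\mathrm{ext}}$ (in particular in a monster model of $\mathrm{Th}(M^{\mathrm{ext}})$): for all $B, B' \subseteq \widetilde M$ with $A \subseteq B$ one has $G^0_{L,B}(\widetilde M) = G^0_{L^{\mathrm{ext}},B'}(\widetilde M)$, where $G(\widetilde M)$ is the group defined in $\widetilde M$ by the formulas that define $G(M)$ in $M$. -/

import Mathlib

open FirstOrder FirstOrder.Language

universe u v w w'

namespace NIPGroup

/-! ### NIP -/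

section NIP

variable {L : FirstOrder.Language.{u, v}} {m n : ℕ}

/-- The tuples `a 0, …, a (k - 1)` of `M` are shattered by the family of sets `φ(M, b)`. -/
def Shatters (M : Type w) [L.Structure M] (φ : L.Formula (Fin m ⊕ Fin n)) {k : ℕ}
    (a : Fin k → Fin m → M) : Prop :=
  ∀ S : Set (Fin k), ∃ b : Fin n → M, ∀ i, φ.Realize (Sum.elim (a i) b) ↔ i ∈ S

/-- The family of sets `φ(M, b)`, for `b` a tuple of `M`, has finite Vapnik-Chervonenkis
dimension. -/
def FormulaNIP (M : Type w) [L.Structure M] (φ : L.Formula (Fin m ⊕ Fin n)) : Prop :=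
  ∃ k : ℕ, ∀ a : Fin k → Fin m → M, ¬ Shatters M φ a

/-- A theory is NIP if, in all its models, every uniformly definable family of definable sets has
finite Vapnik-Chervonenkis dimension. (If `T` is complete, one model decides this, so the
universe in which the models are taken is immaterial as soon as it contains a model.) -/
def TheoryNIP (T : L.Theory) : Prop :=
  ∀ M : T.ModelType.{u, v, w}, ∀ (m n : ℕ) (φ : L.Formula (Fin m ⊕ Fin n)), FormulaNIP M φ

end NIP

/-! ### Externally definable sets and Shelah's expansion -/

section External

variable (L : FirstOrder.Language.{u, v}) {M : Type w} [L.Structure M]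

/-- `X ⊆ Mⁿ` is externally definable if `X = Y ∩ Mⁿ` for some elementary extension `N` of `M` and
some `Y ⊆ Nⁿ` definable in `N` with parameters from `N`. (By Löwenheim-Skolem it is enough to take
`N` in the smallest universe that contains `M` and the formulas of `L`.) -/
def ExternallyDefinable {n : ℕ} (X : Set (Fin n → M)) : Prop :=
  ∃ (N : Type (max u v w)) (_ : L.Structure N) (j : M ↪ₑ[L] N) (Y : Set (Fin n → N)),
    (Set.univ : Set N).Definable L Y ∧ X = {x | (fun i => j (x i)) ∈ Y}

variable (M)

/-- The relational language with one `n`-ary predicate for each externally definable subset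
of `Mⁿ`. -/
def extPredicates : FirstOrder.Language.{0, w} where
  Functions := fun _ => Empty
  Relations := fun n => {X : Set (Fin n → M) // ExternallyDefinable L X}

/-- The language of Shelah's expansion of `M`: the language `L` together with a predicate for each
externally definable subset of a power of `M`. -/
abbrev extLanguage : FirstOrder.Language.{u, max v w} :=
  L.sum (extPredicates L M)

/-- Each new predicate is interpreted by the externally definable set that it names. Together with
the given `L`-structure this makes `M` into a structure for `extLanguage L M`, Shelah's expansion
of `M`. -/
instance extPredicatesStructure : (extPredicates L M).Structure M where
  funMap := fun f => f.elim
  RelMap := fun X x => x ∈ X.1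

end External

/-- An elementary embedding for an expanded language is elementary for the original language. -/
def reduct {L L' : FirstOrder.Language} (F : L →ᴸ L') {M N : Type*} [L.Structure M] [L.Structure N]
    [L'.Structure M] [L'.Structure N] [F.IsExpansionOn M] [F.IsExpansionOn N]
    (j : M ↪ₑ[L'] N) : M ↪ₑ[L] N where
  toFun := j
  map_formula' := fun n φ x => by
    rw [← F.realize_onFormula (M := N), ← F.realize_onFormula (M := M)]
    exact j.map_formula _ x

/-! ### Definable groups -/

section Transfer

variable {L : FirstOrder.Language.{u, v}} {M : Type w} {N : Type w'} [L.Structure M] [L.Structure N]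

theorem transfer_forall (j : M ↪ₑ[L] N) {ι β : Type*} [Finite β] (ψ : L.Formula (ι ⊕ β))
    (c : ι → M) (h : ∀ x : β → M, ψ.Realize (Sum.elim c x)) (x : β → N) :
    ψ.Realize (Sum.elim (j ∘ c) x) := by
  have h1 : (ψ.iAlls β).Realize c := Formula.realize_iAlls.2 h
  exact Formula.realize_iAlls.1 ((j.map_formula _ c).2 h1) x

theorem transfer_forall_exists (j : M ↪ₑ[L] N) {ι β γ : Type*} [Finite β] [Finite γ]
    (ψ : L.Formula ((ι ⊕ β) ⊕ γ)) (c : ι → M)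
    (h : ∀ x : β → M, ∃ z : γ → M, ψ.Realize (Sum.elim (Sum.elim c x) z)) (x : β → N) :
    ∃ z : γ → N, ψ.Realize (Sum.elim (Sum.elim (j ∘ c) x) z) :=
  Formula.realize_iExs.1
    (transfer_forall j (ψ.iExs γ) c (fun y => Formula.realize_iExs.2 (h y)) x)

end Transfer

/-- The restriction to `G` of the relation `P` is the graph of a group operation on `G`. -/
structure IsGroupGraph {X : Type*} (G : Set X) (P : X → X → X → Prop) : Prop where
  total : ∀ a ∈ G, ∀ b ∈ G, ∃ c ∈ G, P a b c
  unique : ∀ a ∈ G, ∀ b ∈ G, ∀ c ∈ G, ∀ d ∈ G, P a b c → P a b d → c = d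
  assoc : ∀ a ∈ G, ∀ b ∈ G, ∀ c ∈ G, ∀ ab ∈ G, ∀ bc ∈ G, ∀ d ∈ G,
    P a b ab → P b c bc → P ab c d → P a bc d
  one_inv : ∃ e ∈ G, (∀ a ∈ G, P e a a) ∧ ∀ a ∈ G, ∃ b ∈ G, P b a e

namespace IsGroupGraph

variable {X : Type*} {G : Set X} {P : X → X → X → Prop}

/-- The product of `a` and `b`: the unique `c ∈ G` with `P a b c`. -/
noncomputable def op (h : IsGroupGraph G P) (a b : G) : G :=
  ⟨(h.total a a.2 b b.2).choose, (h.total a a.2 b b.2).choose_spec.1⟩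

theorem op_spec (h : IsGroupGraph G P) (a b : G) : P a b (h.op a b) :=
  (h.total a a.2 b b.2).choose_spec.2

/-- The group with underlying set `G` whose operation has the graph `P`. -/
noncomputable abbrev group (h : IsGroupGraph G P) : Group G :=
  letI : Mul G := ⟨h.op⟩
  letI : One G := ⟨⟨h.one_inv.choose, h.one_inv.choose_spec.1⟩⟩
  letI : Inv G := ⟨fun a =>
    ⟨(h.one_inv.choose_spec.2.2 a a.2).choose, (h.one_inv.choose_spec.2.2 a a.2).choose_spec.1⟩⟩
  Group.ofLeftAxioms
    (fun a b c => Subtype.ext (h.unique a a.2 (b * c : G) (b * c).2 _ (a * b * c).2 _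
      (a * (b * c)).2
      (h.assoc a a.2 b b.2 c c.2 (a * b : G) (a * b).2 (b * c : G) (b * c).2 _ (a * b * c).2
        (h.op_spec a b) (h.op_spec b c) (h.op_spec (a * b) c))
      (h.op_spec a (b * c))))
    (fun a => Subtype.ext (h.unique (1 : G) (1 : G).2 a a.2 _ (1 * a).2 _ a.2 (h.op_spec 1 a)
      (h.one_inv.choose_spec.2.1 a a.2)))
    (fun a => Subtype.ext (h.unique (a⁻¹ : G) (a⁻¹).2 a a.2 _ (a⁻¹ * a).2 _ (1 : G).2
      (h.op_spec a⁻¹ a) (h.one_inv.choose_spec.2.2 a a.2).choose_spec.2))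

end IsGroupGraph

section DefinableGroup

variable {L : FirstOrder.Language.{u, v}} {M : Type w} [L.Structure M] {A : Set M} {n : ℕ}

/-- The set of solutions in `N` of a formula with parameters from `A ⊆ M`, the parameters being
moved to `N` by `j`. -/
def solutions {N : Type w'} [L.Structure N] (φ : L.Formula (A ⊕ Fin n)) (j : M → N) :
    Set (Fin n → N) :=
  {x | φ.Realize (Sum.elim (fun a => j a) x)}

/-- The ternary relation on `n`-tuples of `N` that is defined by a formula with parameters from
`A ⊆ M`, the parameters being moved to `N` by `j`. -/
def relation {N : Type w'} [L.Structure N] (φ : L.Formula (A ⊕ Fin 3 × Fin n)) (j : M → N)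
    (x y z : Fin n → N) : Prop :=
  φ.Realize (Sum.elim (fun a => j a) (fun p => ![x, y, z] p.1 p.2))

variable (L M A n) in
/-- A group definable in `M` over `A`: its underlying set is a subset of `Mⁿ` defined by a formula
with parameters from `A`, and so is the graph of its operation. -/
structure DefinableGroup where
  carrier : L.Formula (A ⊕ Fin n)
  mul : L.Formula (A ⊕ Fin 3 × Fin n)
  isGroupGraph : IsGroupGraph (solutions carrier (id : M → M)) (relation mul (id : M → M))

namespace DefinableGroup

variable (G : DefinableGroup L M A n) {N : Type w'} [L.Structure N]

theorem realize_carrier {V : Type*} (j : M → N) (p : A → V) (x : Fin n → V) (v : V → N)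
    (hv : v ∘ p = fun a : A => j a) :
    (G.carrier.relabel (Sum.elim p x)).Realize v ↔ v ∘ x ∈ solutions G.carrier j := by
  rw [Formula.realize_relabel, Sum.comp_elim, hv]
  rfl

theorem realize_mul {V : Type*} (j : M → N) (p : A → V) (x y z : Fin n → V) (v : V → N)
    (hv : v ∘ p = fun a : A => j a) :
    (G.mul.relabel (Sum.elim p (fun q => ![x, y, z] q.1 q.2))).Realize v ↔
      relation G.mul j (v ∘ x) (v ∘ y) (v ∘ z) := by
  rw [Formula.realize_relabel, Sum.comp_elim, hv, relation]
  have : (v ∘ fun q : Fin 3 × Fin n => ![x, y, z] q.1 q.2) =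
      fun q => ![v ∘ x, v ∘ y, v ∘ z] q.1 q.2 := by
    funext ⟨i, t⟩
    fin_cases i <;> rfl
  rw [this]

/-- The formulas that define a group in `M` define a group in every elementary extension. -/
theorem isGroupGraph_extension (j : M ↪ₑ[L] N) :
    IsGroupGraph (solutions G.carrier j) (relation G.mul j) := by
  have h := G.isGroupGraph
  refine ⟨fun a ha b hb => ?_, fun a ha b hb c hc d hd h1 h2 => ?_,
    fun a ha b hb c hc ab hab bc hbc d hd h1 h2 h3 => ?_, ?_⟩
  · -- totality
    let p : A → (A ⊕ Fin 2 × Fin n) ⊕ Fin n := fun a => Sum.inl (Sum.inl a)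
    let x : Fin 2 → Fin n → (A ⊕ Fin 2 × Fin n) ⊕ Fin n := fun i t => Sum.inl (Sum.inr (i, t))
    let z : Fin n → (A ⊕ Fin 2 × Fin n) ⊕ Fin n := Sum.inr
    have key := transfer_forall_exists j
      ((G.carrier.relabel (Sum.elim p (x 0))).imp ((G.carrier.relabel (Sum.elim p (x 1))).imp
        (G.carrier.relabel (Sum.elim p z) ⊓
          G.mul.relabel (Sum.elim p (fun q => ![x 0, x 1, z] q.1 q.2)))))
      (fun a : A => (a : M)) (fun y => by
        by_cases hy : (fun t => y (0, t)) ∈ solutions G.carrier (id : M → M) ∧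
          (fun t => y (1, t)) ∈ solutions G.carrier (id : M → M)
        · obtain ⟨c, hc, hm⟩ := h.total _ hy.1 _ hy.2
          refine ⟨c, ?_⟩
          simp only [Formula.realize_imp, Formula.realize_inf]
          rw [G.realize_carrier id p z _ rfl, G.realize_mul id p (x 0) (x 1) z _ rfl]
          exact fun _ _ => ⟨hc, hm⟩
        · refine ⟨fun t => y (0, t), ?_⟩
          simp only [Formula.realize_imp]
          rw [G.realize_carrier id p (x 0) _ rfl, G.realize_carrier id p (x 1) _ rfl]
          exact fun h0 h1 => (hy ⟨h0, h1⟩).elim)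
      (fun q => ![a, b] q.1 q.2)
    obtain ⟨c, hc⟩ := key
    simp only [Formula.realize_imp, Formula.realize_inf] at hc
    rw [G.realize_carrier j p (x 0) _ rfl, G.realize_carrier j p (x 1) _ rfl,
      G.realize_carrier j p z _ rfl, G.realize_mul j p (x 0) (x 1) z _ rfl] at hc
    exact ⟨c, hc ha hb⟩
  · -- uniqueness
    let p : A → A ⊕ Fin 4 × Fin n := Sum.inl
    let x : Fin 4 → Fin n → A ⊕ Fin 4 × Fin n := fun i t => Sum.inr (i, t)
    have key : ∀ t, c t = d t := fun t => by
      have := transfer_forall j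
        ((G.carrier.relabel (Sum.elim p (x 0))).imp ((G.carrier.relabel (Sum.elim p (x 1))).imp
        ((G.carrier.relabel (Sum.elim p (x 2))).imp ((G.carrier.relabel (Sum.elim p (x 3))).imp
        ((G.mul.relabel (Sum.elim p (fun q => ![x 0, x 1, x 2] q.1 q.2))).imp
        ((G.mul.relabel (Sum.elim p (fun q => ![x 0, x 1, x 3] q.1 q.2))).imp
          ((Term.var (x 2 t)).equal (Term.var (x 3 t)))))))))
        (fun a : A => (a : M)) (fun y => by
          simp only [Formula.realize_imp, Formula.realize_equal, Term.realize_var]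
          simp only [G.realize_carrier id p _ (Sum.elim (fun a : A => (a : M)) y) rfl,
            G.realize_mul id p _ _ _ (Sum.elim (fun a : A => (a : M)) y) rfl]
          exact fun h0 h1 h2 h3 h4 h5 => congrFun (h.unique _ h0 _ h1 _ h2 _ h3 h4 h5) t)
        (fun q => ![a, b, c, d] q.1 q.2)
      simp only [Formula.realize_imp, Formula.realize_equal, Term.realize_var] at this
      simp only [G.realize_carrier j p _ (Sum.elim (j ∘ fun a : A => (a : M)) _) rfl,
        G.realize_mul j p _ _ _ (Sum.elim (j ∘ fun a : A => (a : M)) _) rfl] at this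
      exact this ha hb hc hd h1 h2
    exact funext key
  · -- associativity
    let p : A → A ⊕ Fin 6 × Fin n := Sum.inl
    let x : Fin 6 → Fin n → A ⊕ Fin 6 × Fin n := fun i t => Sum.inr (i, t)
    have := transfer_forall j
      ((G.carrier.relabel (Sum.elim p (x 0))).imp ((G.carrier.relabel (Sum.elim p (x 1))).imp
      ((G.carrier.relabel (Sum.elim p (x 2))).imp ((G.carrier.relabel (Sum.elim p (x 3))).imp
      ((G.carrier.relabel (Sum.elim p (x 4))).imp ((G.carrier.relabel (Sum.elim p (x 5))).imp
      ((G.mul.relabel (Sum.elim p (fun q => ![x 0, x 1, x 3] q.1 q.2))).imp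
      ((G.mul.relabel (Sum.elim p (fun q => ![x 1, x 2, x 4] q.1 q.2))).imp
      ((G.mul.relabel (Sum.elim p (fun q => ![x 3, x 2, x 5] q.1 q.2))).imp
        (G.mul.relabel (Sum.elim p (fun q => ![x 0, x 4, x 5] q.1 q.2))))))))))))
      (fun a : A => (a : M)) (fun y => by
        simp only [Formula.realize_imp]
        simp only [G.realize_carrier id p _ (Sum.elim (fun a : A => (a : M)) y) rfl,
          G.realize_mul id p _ _ _ (Sum.elim (fun a : A => (a : M)) y) rfl]
        exact fun h0 h1 h2 h3 h4 h5 h6 h7 h8 =>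
          h.assoc _ h0 _ h1 _ h2 _ h3 _ h4 _ h5 h6 h7 h8)
      (fun q => ![a, b, c, ab, bc, d] q.1 q.2)
    simp only [Formula.realize_imp] at this
    simp only [G.realize_carrier j p _ (Sum.elim (j ∘ fun a : A => (a : M)) _) rfl,
      G.realize_mul j p _ _ _ (Sum.elim (j ∘ fun a : A => (a : M)) _) rfl] at this
    exact this ha hb hc hab hbc hd h1 h2 h3
  · -- the neutral element of `G(M)` is neutral in `G(N)`, and there are left inverses
    obtain ⟨e, he, hmul, hinv⟩ := h.one_inv
    let c : A ⊕ Fin n → M := Sum.elim (fun a : A => (a : M)) e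
    let p : A → ((A ⊕ Fin n) ⊕ Fin n) ⊕ Fin n := fun a => Sum.inl (Sum.inl (Sum.inl a))
    let u : Fin n → ((A ⊕ Fin n) ⊕ Fin n) ⊕ Fin n := fun t => Sum.inl (Sum.inl (Sum.inr t))
    let x : Fin n → ((A ⊕ Fin n) ⊕ Fin n) ⊕ Fin n := fun t => Sum.inl (Sum.inr t)
    let z : Fin n → ((A ⊕ Fin n) ⊕ Fin n) ⊕ Fin n := Sum.inr
    have key := transfer_forall_exists j
      (G.carrier.relabel (Sum.elim p u) ⊓ ((G.carrier.relabel (Sum.elim p x)).imp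
        (G.mul.relabel (Sum.elim p (fun q => ![u, x, x] q.1 q.2)) ⊓
          (G.carrier.relabel (Sum.elim p z) ⊓
            G.mul.relabel (Sum.elim p (fun q => ![z, x, u] q.1 q.2))))))
      c (fun y => by
        by_cases hy : y ∈ solutions G.carrier (id : M → M)
        · obtain ⟨b, hb, hm⟩ := hinv y hy
          refine ⟨b, ?_⟩
          simp only [Formula.realize_imp, Formula.realize_inf]
          rw [G.realize_carrier id p u _ rfl, G.realize_carrier id p z _ rfl,
            G.realize_mul id p z x u _ rfl, G.realize_mul id p u x x _ rfl]
          exact ⟨he, fun _ => ⟨hmul y hy, hb, hm⟩⟩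
        · refine ⟨y, ?_⟩
          simp only [Formula.realize_imp, Formula.realize_inf]
          rw [G.realize_carrier id p u _ rfl, G.realize_carrier id p x _ rfl]
          exact ⟨he, fun h0 => (hy h0).elim⟩)
    have key2 : ∀ y : Fin n → N, j ∘ e ∈ solutions G.carrier j ∧ (y ∈ solutions G.carrier j →
        relation G.mul j (j ∘ e) y y ∧ ∃ b ∈ solutions G.carrier j,
          relation G.mul j b y (j ∘ e)) := fun y => by
      obtain ⟨b, hb⟩ := key y
      simp only [Formula.realize_imp, Formula.realize_inf] at hb
      rw [G.realize_carrier j p u _ rfl, G.realize_carrier j p x _ rfl,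
        G.realize_carrier j p z _ rfl, G.realize_mul j p z x u _ rfl,
        G.realize_mul j p u x x _ rfl] at hb
      exact ⟨hb.1, fun hy => ⟨(hb.2 hy).1, b, (hb.2 hy).2⟩⟩
    exact ⟨j ∘ e, (key2 (j ∘ e)).1, fun y hy => ((key2 y).2 hy).1, fun y hy => ((key2 y).2 hy).2⟩

/-- The set `G(N)` of points in an elementary extension `j : M → N`. -/
def points (j : M ↪ₑ[L] N) : Set (Fin n → N) := solutions G.carrier j

/-- `G(N)` is a group. -/
noncomputable instance (j : M ↪ₑ[L] N) : Group (G.points j) :=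
  (G.isGroupGraph_extension j).group

theorem mul_eq_iff (j : M ↪ₑ[L] N) (a b c : G.points j) :
    a * b = c ↔ relation G.mul j a b c := by
  have h := G.isGroupGraph_extension j
  constructor
  · rintro rfl
    exact h.op_spec a b
  · intro hc
    exact Subtype.ext (h.unique a a.2 b b.2 _ (a * b).2 c c.2 (h.op_spec a b) hc)

end DefinableGroup

end DefinableGroup

/-- A subgroup of a group `G ⊆ X`, as a subset of `X`. -/
def subgroupSet {X : Type*} {G : Set X} [Group G] (H : Subgroup G) : Set X :=
  {x | ∃ g ∈ H, (g : X) = x}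

/-- The connected component `G⁰` over `B` of a group `G ⊆ Nⁿ`: the intersection of all subgroups
of finite index that are definable in the `L`-structure `N` with parameters from `B`. -/
def connectedComponent (L : FirstOrder.Language.{u, v}) {N : Type w} [L.Structure N]
    (B : Set N) {n : ℕ} (G : Set (Fin n → N)) [Group G] : Subgroup G :=
  sInf {H : Subgroup G | H.FiniteIndex ∧ B.Definable L (subgroupSet H)}

end NIPGroup

/-!
Everything rests on finite combinatorics in the given models; neither saturated models nor the
compactness theorem are used. By elementarity, an externally definable set `X` agrees on each
finite set with a member of one definable family (`Approximable`).

*Shelah's theorem.* In a NIP structure an approximable set `X` has an honest definition: there is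
a definable family such that each finite subset of `X` lies in a member of the family that is
contained in `X` (`Approximable.innerApproximable`). The sets that can be exhausted in this
way from within `X` form an ideal. If `X` did not belong to it, an ultrafilter on `X` that avoids
the ideal would play the role of a coheir of which one realizes a Morley sequence alternating
between `X` and its complement (`LargeFor.exists_pairs`); as `X` is approximated by a family of
finite Vapnik-Chervonenkis dimension, this is impossible. Projecting honest definitions shows that
projections of approximable sets are approximable, so all sets definable in Shelah's expansion
are (`approximable_extLanguage_formula`).

*Subgroups of finite index.* By the Baldwin-Saxl lemma (`exists_finset_iInf_eq`), the subgroups of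
index at most `k` in a NIP family intersect in a subgroup of finite index, so there is a uniform
bound on their number. Passing to a limit in free groups, one finds a bound also on the number of
traces, on any finite set, of those members of the family that look like subgroups of index at
most `k` on boundedly many points (`exists_not_hasTraces`). For a finite set `f₀` on which this
number is maximal, a trace on `f₀` determines the membership of any further point, and the
quantifiers in this statement are first-order. Hence an approximable subgroup of finite index is
definable (`exists_mem_iff_of_agree_on_finite`). All its conjugates over `A`, that is, the subgroups
of at most the same index in the family that defines it, intersect in a subgroup of finite index
that is definable over `A` (`DefinableGroup.exists_formula_le`).

*Connected components.* Given a formula of the expanded language, the intersection of the subgroups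
of index at most `k` that its instances define in `G(M)` is approximable and of finite index. So it
contains a subgroup of finite index that is definable over `A` by a formula of `L`, and whose
underlying set is named by a predicate of the expanded language. This containment is a first-order
property and passes to elementary extensions, where it says that the definable subgroups
of finite index in the two languages are coinitial in one another.
-/

namespace NIPGroup

/-! ### Predicates defined by one formula in two structures -/

section JointlyDefinable

variable {L : FirstOrder.Language.{u, v}} {M : Type w} {N : Type w'} [L.Structure M]
  [L.Structure N] {κ : Type*} {a : κ → M} {b : κ → N} {α β : Type*}

variable (L) in
/-- The predicates `P` on tuples of `M` and `Q` on tuples of `N` are defined by the same formula,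
with the parameters `a` in `M` and `b` in `N`. -/
def JointlyDefinable (a : κ → M) (b : κ → N) (P : (α → M) → Prop) (Q : (α → N) → Prop) : Prop :=
  ∃ φ : L.Formula (κ ⊕ α),
    (∀ v, φ.Realize (Sum.elim a v) ↔ P v) ∧ ∀ v, φ.Realize (Sum.elim b v) ↔ Q v

namespace JointlyDefinable

variable {P P' : (α → M) → Prop} {Q Q' : (α → N) → Prop}

theorem of_formula (φ : L.Formula (κ ⊕ α)) :
    JointlyDefinable L a b (fun v : α → M => φ.Realize (Sum.elim a v))
      (fun v => φ.Realize (Sum.elim b v)) :=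
  ⟨φ, fun _ => Iff.rfl, fun _ => Iff.rfl⟩

theorem of_parameterFree_formula (φ : L.Formula α) :
    JointlyDefinable L a b (fun v : α → M => φ.Realize v) (fun v => φ.Realize v) :=
  ⟨φ.relabel Sum.inr, fun v => by rw [Formula.realize_relabel, Sum.elim_comp_inr],
    fun v => by rw [Formula.realize_relabel, Sum.elim_comp_inr]⟩

theorem congr (h : JointlyDefinable L a b P Q) (hP : ∀ v, P v ↔ P' v) (hQ : ∀ v, Q v ↔ Q' v) :
    JointlyDefinable L a b P' Q' := by
  obtain ⟨φ, h1, h2⟩ := h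
  exact ⟨φ, fun v => (h1 v).trans (hP v), fun v => (h2 v).trans (hQ v)⟩

theorem const (p : Prop) : JointlyDefinable L a b (fun _ : α → M => p) (fun _ => p) := by
  by_cases hp : p
  · exact ⟨⊤, fun v => by simp [hp], fun v => by simp [hp]⟩
  · exact ⟨⊥, fun v => by simp [hp], fun v => by simp [hp]⟩

theorem not (h : JointlyDefinable L a b P Q) :
    JointlyDefinable L a b (fun v => ¬ P v) (fun v => ¬ Q v) := by
  obtain ⟨φ, h1, h2⟩ := h
  exact ⟨φ.not, fun v => by rw [Formula.realize_not, h1], fun v => by rw [Formula.realize_not, h2]⟩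

theorem imp (h : JointlyDefinable L a b P Q) (h' : JointlyDefinable L a b P' Q') :
    JointlyDefinable L a b (fun v => P v → P' v) (fun v => Q v → Q' v) := by
  obtain ⟨φ, h1, h2⟩ := h
  obtain ⟨φ', h1', h2'⟩ := h'
  exact ⟨φ.imp φ', fun v => by rw [Formula.realize_imp, h1, h1'],
    fun v => by rw [Formula.realize_imp, h2, h2']⟩

theorem and (h : JointlyDefinable L a b P Q) (h' : JointlyDefinable L a b P' Q') :
    JointlyDefinable L a b (fun v => P v ∧ P' v) (fun v => Q v ∧ Q' v) :=
  (h.imp h'.not).not.congr (fun v => by tauto) (fun v => by tauto)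

theorem iff (h : JointlyDefinable L a b P Q) (h' : JointlyDefinable L a b P' Q') :
    JointlyDefinable L a b (fun v => P v ↔ P' v) (fun v => Q v ↔ Q' v) :=
  ((h.imp h').and (h'.imp h)).congr (fun v => by tauto) (fun v => by tauto)

theorem forall_index {ι : Type*} [Finite ι] {P : ι → (α → M) → Prop} {Q : ι → (α → N) → Prop}
    (h : ∀ i, JointlyDefinable L a b (P i) (Q i)) :
    JointlyDefinable L a b (fun v => ∀ i, P i v) (fun v => ∀ i, Q i v) := by
  choose φ h1 h2 using h
  refine ⟨Formula.iInf φ, fun v => ?_, fun v => ?_⟩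
  · simp only [Formula.realize_iInf, h1]
  · simp only [Formula.realize_iInf, h2]

theorem exists_index {ι : Type*} [Finite ι] {P : ι → (α → M) → Prop} {Q : ι → (α → N) → Prop}
    (h : ∀ i, JointlyDefinable L a b (P i) (Q i)) :
    JointlyDefinable L a b (fun v => ∃ i, P i v) (fun v => ∃ i, Q i v) :=
  (forall_index fun i => (h i).not).not.congr (fun v => by simp) (fun v => by simp)

theorem subst (h : JointlyDefinable L a b P Q) (t : α → L.Term β) :
    JointlyDefinable L a b (fun v : β → M => P (fun i => (t i).realize v))
      (fun v => Q (fun i => (t i).realize v)) := by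
  obtain ⟨φ, h1, h2⟩ := h
  refine ⟨BoundedFormula.subst φ
    (Sum.elim (fun k => Term.var (Sum.inl k)) (fun i => (t i).relabel Sum.inr)),
    fun v => ?_, fun v => ?_⟩
  · refine Iff.trans ?_ (h1 _)
    rw [Formula.Realize, BoundedFormula.realize_subst, ← Formula.Realize]
    refine iff_of_eq (congrArg _ ?_)
    funext k
    cases k <;> simp
  · refine Iff.trans ?_ (h2 _)
    rw [Formula.Realize, BoundedFormula.realize_subst, ← Formula.Realize]
    refine iff_of_eq (congrArg _ ?_)
    funext k
    cases k <;> simp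

/-- Variables may be renamed, identified, and replaced by parameters. -/
theorem reindex (h : JointlyDefinable L a b P Q) (g : α → κ ⊕ β) :
    JointlyDefinable L a b (fun v : β → M => P (fun i => Sum.elim a v (g i)))
      (fun v => Q (fun i => Sum.elim b v (g i))) := by
  obtain ⟨φ, h1, h2⟩ := h
  refine ⟨φ.relabel (Sum.elim Sum.inl g), fun v => ?_, fun v => ?_⟩
  · refine Iff.trans ?_ (h1 _)
    rw [Formula.realize_relabel, Sum.comp_elim, Sum.elim_comp_inl]
    rfl
  · refine Iff.trans ?_ (h2 _)
    rw [Formula.realize_relabel, Sum.comp_elim, Sum.elim_comp_inl]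
    rfl

theorem comp (h : JointlyDefinable L a b P Q) (g : α → β) :
    JointlyDefinable L a b (fun v : β → M => P (fun i => v (g i))) (fun v => Q fun i => v (g i)) :=
  h.reindex (fun i => Sum.inr (g i))

theorem forall_tuple [Finite β] {P : (α ⊕ β → M) → Prop} {Q : (α ⊕ β → N) → Prop}
    (h : JointlyDefinable L a b P Q) :
    JointlyDefinable L a b (fun v => ∀ w : β → M, P (Sum.elim v w))
      (fun v => ∀ w : β → N, Q (Sum.elim v w)) := by
  obtain ⟨φ, h1, h2⟩ := h
  refine ⟨(φ.relabel (Equiv.sumAssoc κ α β).symm).iAlls β, fun v => ?_, fun v => ?_⟩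
  · rw [Formula.realize_iAlls]
    refine forall_congr' fun w => ?_
    rw [← h1, Formula.realize_relabel]
    refine iff_of_eq (congrArg _ ?_)
    funext k
    rcases k with k | k | k <;> rfl
  · rw [Formula.realize_iAlls]
    refine forall_congr' fun w => ?_
    rw [← h2, Formula.realize_relabel]
    refine iff_of_eq (congrArg _ ?_)
    funext k
    rcases k with k | k | k <;> rfl

theorem exists_tuple [Finite β] {P : (α ⊕ β → M) → Prop} {Q : (α ⊕ β → N) → Prop}
    (h : JointlyDefinable L a b P Q) :
    JointlyDefinable L a b (fun v => ∃ w : β → M, P (Sum.elim v w))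
      (fun v => ∃ w : β → N, Q (Sum.elim v w)) :=
  h.not.forall_tuple.not.congr (fun v => by simp) (fun v => by simp)

theorem eq_var (i i' : α) :
    JointlyDefinable L a b (fun v : α → M => v i = v i') (fun v => v i = v i') :=
  (of_parameterFree_formula ((Term.var i).equal (Term.var i'))).congr
    (fun v => by simp) (fun v => by simp)

theorem map_language {L' : FirstOrder.Language} [L'.Structure M] [L'.Structure N] (F : L →ᴸ L')
    [F.IsExpansionOn M] [F.IsExpansionOn N] (h : JointlyDefinable L a b P Q) :
    JointlyDefinable L' a b P Q := by
  obtain ⟨φ, h1, h2⟩ := h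
  exact ⟨F.onFormula φ, fun v => (F.realize_onFormula φ).trans (h1 v),
    fun v => (F.realize_onFormula φ).trans (h2 v)⟩

theorem left (h : JointlyDefinable L a b P Q) : JointlyDefinable L a a P P := by
  obtain ⟨φ, h1, h2⟩ := h
  exact ⟨φ, h1, h1⟩

theorem right (h : JointlyDefinable L a b P Q) : JointlyDefinable L b b Q Q := by
  obtain ⟨φ, h1, h2⟩ := h
  exact ⟨φ, h2, h2⟩

theorem elementary_iff (j : M ↪ₑ[L] N) (h : JointlyDefinable L a (fun k => j (a k)) P Q)
    (v : α → M) : Q (fun i => j (v i)) ↔ P v := by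
  obtain ⟨φ, h1, h2⟩ := h
  rw [← h1, ← h2, ← j.map_formula]
  refine iff_of_eq (congrArg _ ?_)
  funext k
  cases k <;> rfl

/-- A universal statement goes up along an elementary embedding. -/
theorem transfer (j : M ↪ₑ[L] N) [Finite α] (h : JointlyDefinable L a (fun k => j (a k)) P Q)
    (hP : ∀ v, P v) (v : α → N) : Q v := by
  obtain ⟨φ, h1, h2⟩ := h
  exact (h2 v).1 (transfer_forall j φ a (fun x => (h1 x).2 (hP x)) v)

theorem definable {P : (α → M) → Prop} (h : JointlyDefinable L a a P P) {A : Set M}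
    (hA : ∀ k, a k ∈ A) : A.Definable L {v | P v} := by
  obtain ⟨φ, h1, -⟩ := h
  refine Set.definable_iff_exists_formula_sum.2
    ⟨φ.relabel (Sum.map (fun k => (⟨a k, hA k⟩ : A)) id), ?_⟩
  ext v
  have : (Sum.elim (fun k : A => (k : M)) v) ∘ Sum.map (fun k => (⟨a k, hA k⟩ : A)) id =
      Sum.elim a v := by
    funext k
    cases k <;> rfl
  change P v ↔ (φ.relabel _).Realize _
  rw [Formula.realize_relabel, this, h1]

end JointlyDefinable

variable (L) in
/-- A predicate on tuples of `M` that is defined by a formula with parameters from `M`. -/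
abbrev ParamDefinable (P : (α → M) → Prop) : Prop :=
  JointlyDefinable L (id : M → M) (id : M → M) P P

theorem _root_.Set.Definable.paramDefinable {A : Set M} {S : Set (α → M)} (h : A.Definable L S) :
    ParamDefinable L (fun v => v ∈ S) := by
  obtain ⟨φ, rfl⟩ := Set.definable_iff_exists_formula_sum.1 h
  have key : ∀ v : α → M, (φ.relabel (Sum.map (fun k : A => (k : M)) id)).Realize (Sum.elim id v) ↔
      v ∈ {v : α → M | φ.Realize (Sum.elim (fun k : A => (k : M)) v)} := fun v => by
    rw [Formula.realize_relabel]
    refine iff_of_eq (congrArg _ ?_)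
    funext k
    cases k <;> rfl
  exact ⟨_, key, key⟩

theorem ParamDefinable.definable {P : (α → M) → Prop} (h : ParamDefinable L P) :
    (Set.univ : Set M).Definable L {v | P v} :=
  JointlyDefinable.definable h fun _ => Set.mem_univ _

theorem ParamDefinable.fix_right {P : (α ⊕ β → M) → Prop} (h : ParamDefinable L P) (c : β → M) :
    ParamDefinable L (fun v => P (Sum.elim v c)) := by
  refine (h.reindex (Sum.elim Sum.inr (fun i => Sum.inl (c i)))).congr (fun v => ?_) (fun v => ?_)
  all_goals
    refine iff_of_eq (congrArg P ?_)
    funext k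
    cases k <;> rfl

/-- A formula uses finitely many of its parameters, which may be turned into variables. -/
theorem JointlyDefinable.exists_finite_parameters {P : (α → M) → Prop}
    (h : JointlyDefinable L a a P P) :
    ∃ (p : ℕ) (d : Fin p → κ) (φ : L.Formula (α ⊕ Fin p)),
      ∀ v, φ.Realize (Sum.elim v (fun i => a (d i))) ↔ P v := by
  classical
  obtain ⟨φ, h1, -⟩ := h
  let s : Finset κ := φ.freeVarFinset.toLeft
  let e := s.equivFin
  let f : φ.freeVarFinset → α ⊕ Fin s.card := fun x =>
    match x with
    | ⟨Sum.inl k, hk⟩ => Sum.inr (e ⟨k, Finset.mem_toLeft.2 hk⟩)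
    | ⟨Sum.inr i, _⟩ => Sum.inl i
  refine ⟨s.card, fun i => (e.symm i : κ), BoundedFormula.restrictFreeVar φ f, fun v => ?_⟩
  rw [← h1]
  refine BoundedFormula.realize_restrictFreeVar _ ?_
  rintro ⟨k | i, hk⟩ <;> simp [f]

end JointlyDefinable

end NIPGroup

namespace NIPGroup

/-! ### Finite Vapnik-Chervonenkis dimension -/

/-- The family of sets `{x | R x c}` has finite Vapnik-Chervonenkis dimension. -/
def FiniteVC {V C : Type*} (R : V → C → Prop) : Prop :=
  ∃ k : ℕ, ∀ a : Fin k → V, ¬ ∀ S : Set (Fin k), ∃ c, ∀ i, R (a i) c ↔ i ∈ S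

variable (L : FirstOrder.Language.{u, v}) (M : Type w) [L.Structure M]

/-- A structure is NIP if every parameter-free formula has finite Vapnik-Chervonenkis dimension
in it. -/
def StructureNIP : Prop :=
  ∀ (m n : ℕ) (φ : L.Formula (Fin m ⊕ Fin n)), FormulaNIP M φ

variable {L M}

/-- In a NIP structure, formulas with parameters have finite Vapnik-Chervonenkis dimension. -/
theorem StructureNIP.finiteVC (hM : StructureNIP L M) {κ : Type*} {d : κ → M} {α β : Type*}
    [Finite α] [Finite β] {E : (α ⊕ β → M) → Prop} (hE : JointlyDefinable L d d E E) :
    FiniteVC (fun (x : α → M) (c : β → M) => E (Sum.elim x c)) := by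
  obtain ⟨p, e, φ, hφ⟩ := hE.exists_finite_parameters
  obtain ⟨m, ⟨eα⟩⟩ := Finite.exists_equiv_fin α
  obtain ⟨n, ⟨eβ⟩⟩ := Finite.exists_equiv_fin (β ⊕ Fin p)
  let g : (α ⊕ β) ⊕ Fin p → Fin m ⊕ Fin n :=
    Sum.elim (Sum.map eα (fun i => eβ (Sum.inl i))) (fun i => Sum.inr (eβ (Sum.inr i)))
  obtain ⟨k, hk⟩ := hM m n (φ.relabel g)
  refine ⟨k, fun a ha => hk (fun i t => a i (eα.symm t)) fun S => ?_⟩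
  obtain ⟨c, hc⟩ := ha S
  refine ⟨fun t => Sum.elim c (fun i => d (e i)) (eβ.symm t), fun i => ?_⟩
  refine Iff.trans ?_ (hc i)
  refine Iff.trans ?_ (hφ _)
  rw [Formula.realize_relabel]
  refine iff_of_eq (congrArg _ ?_)
  funext x
  rcases x with (x | x) | x <;> simp [g]

/-! ### Honest definitions -/

variable {α β : Type}

variable (L) in
/-- The set `X` agrees on every finite set with a member of a fixed definable family. By
compactness this says that `X` is externally definable. -/
def Approximable (X : Set (α → M)) : Prop :=
  ∃ (γ : Type) (_ : Finite γ) (E : (α ⊕ γ → M) → Prop), ParamDefinable L E ∧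
    ∀ F : Set (α → M), F.Finite → ∃ c : γ → M, ∀ x ∈ F, E (Sum.elim x c) ↔ x ∈ X

variable (L) in
/-- Every finite subset of `Y` is contained in a subset of `X` that belongs to a fixed definable
family. -/
def InnerApproximable (X Y : Set (α → M)) : Prop :=
  ∃ (γ : Type) (_ : Finite γ) (E : (α ⊕ γ → M) → Prop), ParamDefinable L E ∧
    ∀ F : Set (α → M), F.Finite → F ⊆ Y →
      ∃ c : γ → M, (∀ x ∈ F, E (Sum.elim x c)) ∧ ∀ x, E (Sum.elim x c) → x ∈ X

theorem InnerApproximable.empty (X : Set (α → M)) : InnerApproximable L X ∅ :=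
  ⟨Fin 0, inferInstance, fun _ => False, JointlyDefinable.const _, fun _ _ hF =>
    ⟨Fin.elim0, fun _ hx => hF hx, fun _ h => h.elim⟩⟩

theorem InnerApproximable.mono {X Y Y' : Set (α → M)} (h : InnerApproximable L X Y)
    (hY : Y' ⊆ Y) : InnerApproximable L X Y' := by
  obtain ⟨γ, hγ, E, hE, hF⟩ := h
  exact ⟨γ, hγ, E, hE, fun F h1 h2 => hF F h1 (h2.trans hY)⟩

theorem InnerApproximable.union {X Y Y' : Set (α → M)} (h : InnerApproximable L X Y)
    (h' : InnerApproximable L X Y') : InnerApproximable L X (Y ∪ Y') := by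
  obtain ⟨γ, hγ, E, hE, hF⟩ := h
  obtain ⟨γ', hγ', E', hE', hF'⟩ := h'
  refine ⟨γ ⊕ γ', inferInstance,
    fun v => ¬ E (fun i => v (Sum.map id Sum.inl i)) → E' (fun i => v (Sum.map id Sum.inr i)),
    (hE.comp _).not.imp (hE'.comp _), fun F h1 h2 => ?_⟩
  obtain ⟨c, hc, hcX⟩ := hF (F ∩ Y) (h1.subset Set.inter_subset_left) Set.inter_subset_right
  obtain ⟨c', hc', hcX'⟩ := hF' (F ∩ Y') (h1.subset Set.inter_subset_left) Set.inter_subset_right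
  have e1 : ∀ x : α → M, (fun i => Sum.elim x (Sum.elim c c') (Sum.map id Sum.inl i)) =
      Sum.elim x c := fun x => by
    funext i
    cases i <;> rfl
  have e2 : ∀ x : α → M, (fun i => Sum.elim x (Sum.elim c c') (Sum.map id Sum.inr i)) =
      Sum.elim x c' := fun x => by
    funext i
    cases i <;> rfl
  refine ⟨Sum.elim c c', fun x hx => ?_, fun x => ?_⟩
  · beta_reduce
    rw [e1, e2]
    rcases h2 hx with h | h
    · exact fun h' => (h' (hc x ⟨hx, h⟩)).elim
    · exact fun _ => hc' x ⟨hx, h⟩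
  · beta_reduce
    rw [e1, e2]
    intro h
    by_cases hx : E (Sum.elim x c)
    · exact hcX x hx
    · exact hcX' x (h hx)

/-- The predicate `D` holds for almost all tuples, with respect to the iterated product of the
filter `U`. -/
def LargeFor {V : Type*} (U : Filter V) : (n : ℕ) → ((Fin n → V) → Prop) → Prop
  | 0, D => D Fin.elim0
  | n + 1, D => ∀ᶠ b in U, LargeFor U n (fun c => D (Fin.cons b c))

namespace LargeFor

variable {V : Type*} {U : Filter V}

theorem forall_of_finite {ι : Type*} [Finite ι] {n : ℕ} {D : ι → (Fin n → V) → Prop}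
    (h : ∀ i, LargeFor U n (D i)) : LargeFor U n (fun c => ∀ i, D i c) := by
  induction n with
  | zero => exact h
  | succ n ih =>
    filter_upwards [Filter.eventually_all.2 h] with b hb
    exact ih hb

theorem or_not (U : Ultrafilter V) (n : ℕ) (D : (Fin n → V) → Prop) :
    LargeFor (U : Filter V) n D ∨ LargeFor (U : Filter V) n (fun c => ¬ D c) := by
  induction n with
  | zero => exact em _
  | succ n ih =>
    by_cases h : ∀ᶠ b in (U : Filter V), LargeFor (U : Filter V) n (fun c => D (Fin.cons b c))
    · exact Or.inl h
    · right
      filter_upwards [Ultrafilter.eventually_not.2 h] with b hb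
      exact (ih _).resolve_left hb

theorem exists_tuple [U.NeBot] {n : ℕ} {D : (Fin n → V) → Prop} (h : LargeFor U n D) :
    ∃ c, D c := by
  induction n with
  | zero => exact ⟨_, h⟩
  | succ n ih =>
    obtain ⟨b, hb⟩ := Filter.Eventually.exists h
    obtain ⟨c, hc⟩ := ih hb
    exact ⟨_, hc⟩

/-- Suppose that no set of the ultrafilter `U` can be approximated from within `X`. Then a definable
predicate that holds for almost all tuples holds for all choices of one point from each of `n`
pairs, each of which consists of a point of `X` and a point outside of `X`. -/
theorem exists_pairs {X : Set (α → M)} {U : Ultrafilter (α → M)} [Finite α] (hX : X ∈ U)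
    (hU : ∀ Y, InnerApproximable L X Y → Y ∉ U) (n : ℕ) {D : (Fin n → α → M) → Prop}
    (hD : ParamDefinable L (fun v : Fin n × α → M => D (fun i t => v (i, t))))
    (h : LargeFor (U : Filter (α → M)) n D) :
    ∃ a : Fin n → Bool → α → M, (∀ i, a i true ∈ X ∧ a i false ∉ X) ∧
      ∀ ε : Fin n → Bool, D (fun i => a i (ε i)) := by
  induction n with
  | zero =>
    refine ⟨Fin.elim0, fun i => i.elim0, fun ε => ?_⟩
    have : (fun i : Fin 0 => (Fin.elim0 : Fin 0 → Bool → α → M) i (ε i)) = Fin.elim0 :=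
      Subsingleton.elim _ _
    rw [this]
    exact h
  | succ n ih =>
    let B : Set (α → M) := {b | LargeFor (U : Filter (α → M)) n (fun c => D (Fin.cons b c))}
    have hB : B ∈ U := h
    -- pairs that work for finitely many first entries `b` at once
    have key : ∀ F : Set (α → M), F.Finite → F ⊆ B → ∃ a : Fin n → Bool → α → M,
        (∀ i, a i true ∈ X ∧ a i false ∉ X) ∧
          ∀ ε : Fin n → Bool, ∀ b : F, D (Fin.cons (b : α → M) (fun i => a i (ε i))) := by
      intro F hF hFB
      have : Finite F := hF
      refine ih (D := fun c => ∀ b : F, D (Fin.cons (b : α → M) c)) ?_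
        (forall_of_finite fun b => hFB b.2)
      refine JointlyDefinable.forall_index fun b => ?_
      refine (hD.reindex (β := Fin n × α) fun p =>
        Fin.cases (Sum.inl ((b : α → M) p.2)) (fun i => Sum.inr (i, p.2)) p.1).congr
        (fun v => ?_) (fun v => ?_)
      all_goals
        refine iff_of_eq (congrArg D ?_)
        funext i t
        refine Fin.cases ?_ (fun i => ?_) i <;> simp
    by_contra hcon
    refine hU B ?_ hB
    refine ⟨Fin n × Bool × α, inferInstance, fun v => ∀ ε : Fin n → Bool,
      D (Fin.cons (fun t => v (Sum.inl t)) (fun i t => v (Sum.inr (i, ε i, t)))), ?_, ?_⟩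
    · refine JointlyDefinable.forall_index fun ε => ?_
      refine (hD.comp (β := α ⊕ Fin n × Bool × α) fun p =>
        Fin.cases (Sum.inl p.2) (fun i => Sum.inr (i, ε i, p.2)) p.1).congr
        (fun v => ?_) (fun v => ?_)
      all_goals
        refine iff_of_eq (congrArg D ?_)
        funext i t
        refine Fin.cases ?_ (fun i => ?_) i <;> simp
    · intro F hF hFB
      obtain ⟨b₀, hb₀, hb₀X⟩ := Filter.nonempty_of_mem (Filter.inter_mem hB hX)
      obtain ⟨a, haX, ha⟩ := key (insert b₀ F) (hF.insert _) (Set.insert_subset hb₀ hFB)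
      refine ⟨fun p => a p.1 p.2.1 p.2.2,
        fun x hx ε => ha ε ⟨x, Set.mem_insert_of_mem _ hx⟩, fun x hx => ?_⟩
      -- a point outside of `X` would complete `b₀` to a further pair
      by_contra hxX
      refine hcon ⟨Fin.cons (fun s => bif s then b₀ else x) a,
        Fin.cases ⟨hb₀X, hxX⟩ haX, fun ε => ?_⟩
      have e : (fun i => (Fin.cons (fun s => bif s then b₀ else x) a : Fin (n + 1) → Bool → α → M) i
          (ε i)) = Fin.cons (bif ε 0 then b₀ else x) (fun i => a i (ε i.succ)) := by
        funext i
        refine Fin.cases ?_ (fun i => ?_) i <;> simp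
      rw [e]
      cases ε 0
      · exact hx _
      · exact ha _ ⟨b₀, Set.mem_insert _ _⟩

end LargeFor

/-- Honest definitions: in a NIP structure, an externally definable set is the directed union of
a definable family of its subsets. -/
theorem Approximable.innerApproximable [Finite α] (hM : StructureNIP L M) {X : Set (α → M)}
    (hX : Approximable L X) : InnerApproximable L X X := by
  classical
  by_contra hcon
  -- an ultrafilter on `X` that avoids the ideal of sets approximable from within `X`
  let f : Filter (α → M) :=
    { sets := {S | InnerApproximable L X (X \ S)}
      univ_sets := by
        change InnerApproximable L X (X \ Set.univ)
        rw [Set.sdiff_univ]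
        exact InnerApproximable.empty X
      sets_of_superset := fun h hST => InnerApproximable.mono h (Set.sdiff_subset_sdiff_right hST)
      inter_sets := fun {S T} h h' => by
        change InnerApproximable L X (X \ (S ∩ T))
        rw [Set.sdiff_inter]
        exact InnerApproximable.union h h' }
  have hf : f.NeBot := by
    refine Filter.neBot_iff.2 fun h => hcon ?_
    have : (∅ : Set (α → M)) ∈ f := h ▸ Filter.mem_bot
    have h2 : InnerApproximable L X (X \ ∅) := this
    rwa [Set.sdiff_empty] at h2
  let U : Ultrafilter (α → M) := Ultrafilter.of f
  have hUf : ∀ S, InnerApproximable L X (X \ S) → S ∈ U := fun S hS => Ultrafilter.of_le f hS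
  have hXU : X ∈ U := hUf X (by
    rw [Set.sdiff_self]
    exact InnerApproximable.empty X)
  have hU : ∀ Y, InnerApproximable L X Y → Y ∉ U := fun Y hY hYU => by
    have : Yᶜ ∈ U := hUf _ (hY.mono fun x hx => by simpa using hx.2)
    exact Ultrafilter.compl_notMem_iff.2 hYU this
  obtain ⟨γ, hγ, E, hE, hF⟩ := hX
  obtain ⟨l, hl⟩ := hM.finiteVC hE
  -- every pattern on an `l`-tuple is realized by a member of the family, for almost all tuples
  have hlarge : ∀ ε : Fin l → Bool, LargeFor (U : Filter (α → M)) l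
      (fun c => ∃ d : γ → M, ∀ i, E (Sum.elim (c i) d) ↔ ε i = true) := by
    intro ε
    refine (LargeFor.or_not U l _).resolve_right fun hn => ?_
    have hdef : ParamDefinable L (fun v : Fin l × α → M =>
        ∃ d : γ → M, ∀ i, E (Sum.elim (fun t => v (i, t)) d) ↔ ε i = true) := by
      refine JointlyDefinable.congr (JointlyDefinable.exists_tuple (β := γ)
        (P := fun v => ∀ i : Fin l, E (fun k => v (Sum.map (fun t => (i, t)) id k)) ↔ ε i = true)
        (Q := fun v => ∀ i : Fin l, E (fun k => v (Sum.map (fun t => (i, t)) id k)) ↔ ε i = true)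
        (JointlyDefinable.forall_index fun i => (hE.comp _).iff (JointlyDefinable.const _)))
        (fun v => ?_) (fun v => ?_)
      all_goals
        refine exists_congr fun d => forall_congr' fun i => iff_congr
          (iff_of_eq (congrArg E ?_)) Iff.rfl
        funext k
        cases k <;> rfl
    obtain ⟨a, haX, ha⟩ := LargeFor.exists_pairs hXU hU l hdef.not hn
    obtain ⟨c, hc⟩ := hF (Set.range fun p : Fin l × Bool => a p.1 p.2) (Set.finite_range _)
    refine ha ε ⟨c, fun i => ?_⟩
    rw [hc _ ⟨(i, ε i), rfl⟩]
    cases hi : ε i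
    · simpa using (haX i).2
    · simpa using (haX i).1
  obtain ⟨c, hc⟩ := (LargeFor.forall_of_finite hlarge).exists_tuple
  refine hl c fun S => ?_
  obtain ⟨d, hd⟩ := hc (fun i => decide (i ∈ S))
  exact ⟨d, fun i => (hd i).trans decide_eq_true_iff⟩

end NIPGroup

namespace NIPGroup

variable {L : FirstOrder.Language.{u, v}} {M : Type w} [L.Structure M] {α β : Type}

/-! ### Sets definable in Shelah's expansion are externally definable -/

namespace Approximable

theorem of_paramDefinable {P : (α → M) → Prop} (h : ParamDefinable L P) :
    Approximable L {v | P v} :=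
  ⟨Fin 0, inferInstance, fun v => P (fun i => v (Sum.inl i)), h.comp _,
    fun _ _ => ⟨Fin.elim0, fun _ _ => Iff.rfl⟩⟩

theorem imp {P Q : (α → M) → Prop} (h : Approximable L {v | P v}) (h' : Approximable L {v | Q v}) :
    Approximable L {v | P v → Q v} := by
  obtain ⟨γ, hγ, E, hE, hF⟩ := h
  obtain ⟨γ', hγ', E', hE', hF'⟩ := h'
  refine ⟨γ ⊕ γ', inferInstance,
    fun v => E (fun i => v (Sum.map id Sum.inl i)) → E' (fun i => v (Sum.map id Sum.inr i)),
    (hE.comp _).imp (hE'.comp _), fun F h1 => ?_⟩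
  obtain ⟨c, hc⟩ := hF F h1
  obtain ⟨c', hc'⟩ := hF' F h1
  have e1 : ∀ x : α → M, (fun i => Sum.elim x (Sum.elim c c') (Sum.map id Sum.inl i)) =
      Sum.elim x c := fun x => by
    funext i
    cases i <;> rfl
  have e2 : ∀ x : α → M, (fun i => Sum.elim x (Sum.elim c c') (Sum.map id Sum.inr i)) =
      Sum.elim x c' := fun x => by
    funext i
    cases i <;> rfl
  refine ⟨Sum.elim c c', fun x hx => ?_⟩
  beta_reduce
  rw [e1, e2, hc x hx, hc' x hx]
  rfl

theorem not {P : (α → M) → Prop} (h : Approximable L {v | P v}) :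
    Approximable L {v | ¬ P v} :=
  h.imp (Q := fun _ => False) (of_paramDefinable (JointlyDefinable.const False))

theorem and {P Q : (α → M) → Prop} (h : Approximable L {v | P v}) (h' : Approximable L {v | Q v}) :
    Approximable L {v | P v ∧ Q v} := by
  have := (h.imp h'.not).not
  simpa using this

theorem forall_mem_finset {ι : Type*} (s : Finset ι) {P : ι → (α → M) → Prop}
    (h : ∀ i ∈ s, Approximable L {v | P i v}) : Approximable L {v | ∀ i ∈ s, P i v} := by
  classical
  induction s using Finset.induction_on with
  | empty => simpa using of_paramDefinable (JointlyDefinable.const (L := L) (α := α) True)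
  | insert i s _ ih =>
    have h1 := (h i (Finset.mem_insert_self i s)).and
      (ih fun k hk => h k (Finset.mem_insert_of_mem hk))
    simpa [Finset.forall_mem_insert] using h1

theorem subst {P : (α → M) → Prop} (h : Approximable L {v | P v}) (t : α → L.Term β) :
    Approximable L {v : β → M | P (fun i => (t i).realize v)} := by
  obtain ⟨γ, hγ, E, hE, hF⟩ := h
  refine ⟨γ, hγ, _, hE.subst (Sum.elim (fun i => (t i).relabel Sum.inl)
    (fun i => Term.var (Sum.inr i))), fun F h1 => ?_⟩
  obtain ⟨c, hc⟩ := hF ((fun v i => (t i).realize v) '' F) (h1.image _)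
  refine ⟨c, fun x hx => Iff.trans (iff_of_eq (congrArg E ?_)) (hc _ ⟨x, hx, rfl⟩)⟩
  funext k
  cases k <;> simp

theorem comp {P : (α → M) → Prop} (h : Approximable L {v | P v}) (g : α → β) :
    Approximable L {v : β → M | P (fun i => v (g i))} :=
  h.subst (fun i => Term.var (g i))

theorem fix_left {P : (β ⊕ α → M) → Prop} (h : Approximable L {v | P v}) (d : β → M) :
    Approximable L {v : α → M | P (Sum.elim d v)} := by
  obtain ⟨γ, hγ, E, hE, hF⟩ := h
  have key : ∀ (x : α → M) (c : γ → M), (fun k => Sum.elim id (Sum.elim x c)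
      (Sum.elim (Sum.elim (fun i => Sum.inl (d i)) fun i => Sum.inr (Sum.inl i))
        (fun i => Sum.inr (Sum.inr i)) k : M ⊕ (α ⊕ γ))) = Sum.elim (Sum.elim d x) c := by
    intro x c
    funext k
    rcases k with (k | k) | k <;> rfl
  refine ⟨γ, hγ, _, hE.reindex (Sum.elim (Sum.elim (fun i => Sum.inl (d i))
    fun i => Sum.inr (Sum.inl i)) (fun i => Sum.inr (Sum.inr i))), fun F h1 => ?_⟩
  obtain ⟨c, hc⟩ := hF ((fun v => Sum.elim d v) '' F) (h1.image _)
  exact ⟨c, fun x hx => Iff.trans (iff_of_eq (congrArg E (key x c))) (hc _ ⟨x, hx, rfl⟩)⟩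

/-- The approximating family may be taken parameter-free. -/
theorem exists_formula {X : Set (α → M)} (h : Approximable L X) :
    ∃ (p : ℕ) (φ : L.Formula (α ⊕ Fin p)), ∀ F : Set (α → M), F.Finite →
      ∃ c : Fin p → M, ∀ x ∈ F, φ.Realize (Sum.elim x c) ↔ x ∈ X := by
  obtain ⟨γ, hγ, E, hE, hF⟩ := h
  obtain ⟨p, d, φ, hφ⟩ := hE.exists_finite_parameters
  obtain ⟨q, ⟨e⟩⟩ := Finite.exists_equiv_fin (γ ⊕ Fin p)
  refine ⟨q, φ.relabel (Sum.elim (Sum.map id fun i => e (Sum.inl i))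
    fun i => Sum.inr (e (Sum.inr i))), fun F h1 => ?_⟩
  obtain ⟨c, hc⟩ := hF F h1
  refine ⟨fun i => Sum.elim c d (e.symm i), fun x hx => Iff.trans ?_ (hc x hx)⟩
  rw [← hφ, Formula.realize_relabel]
  refine iff_of_eq (congrArg _ ?_)
  funext k
  rcases k with (k | k) | k <;> simp

theorem finiteVC (hM : StructureNIP L M) [Finite α] [Finite β] {P : (α ⊕ β → M) → Prop}
    (h : Approximable L {v | P v}) :
    FiniteVC (fun (x : α → M) (c : β → M) => P (Sum.elim x c)) := by
  obtain ⟨γ, hγ, E, hE, hF⟩ := h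
  obtain ⟨l, hl⟩ := hM.finiteVC (hE.comp (Equiv.sumAssoc α β γ))
  refine ⟨l, fun a ha => hl a fun S => ?_⟩
  choose b hb using ha
  obtain ⟨c, hc⟩ := hF (Set.range fun p : Fin l × Set (Fin l) => Sum.elim (a p.1) (b p.2))
    (Set.finite_range _)
  refine ⟨Sum.elim (b S) c, fun i => ?_⟩
  refine Iff.trans (iff_of_eq (congrArg E ?_)) ((hc _ ⟨(i, S), rfl⟩).trans (hb S i))
  funext k
  rcases k with (k | k) | k <;> rfl

/-- In a NIP structure, the projection of an externally definable set is externally definable: by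
honest definitions, its finite subsets are projections of finite sets that are contained in a
definable subset. -/
theorem exists_tuple (hM : StructureNIP L M) [Finite α] [Finite β] {P : (α ⊕ β → M) → Prop}
    (h : Approximable L {v | P v}) :
    Approximable L {v : α → M | ∃ w : β → M, P (Sum.elim v w)} := by
  cases isEmpty_or_nonempty (β → M)
  · simpa using of_paramDefinable (JointlyDefinable.const (L := L) (α := α) False)
  obtain ⟨γ, hγ, E, hE, hF⟩ := h.innerApproximable hM
  refine ⟨γ, hγ, _, JointlyDefinable.exists_tuple (β := β) (hE.comp (β := (α ⊕ γ) ⊕ β)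
    (Sum.elim (Sum.map Sum.inl id) fun i => Sum.inl (Sum.inr i))), fun F h1 => ?_⟩
  have key : ∀ (x : α → M) (c : γ → M) (y : β → M), (fun k => Sum.elim (Sum.elim x c) y
      (Sum.elim (Sum.map Sum.inl id) (fun i => Sum.inl (Sum.inr i)) k : (α ⊕ γ) ⊕ β)) =
      Sum.elim (Sum.elim x y) c := by
    intro x c y
    funext k
    rcases k with (k | k) | k <;> rfl
  have hw : ∀ x : α → M, ∃ w : β → M, (∃ w : β → M, P (Sum.elim x w)) → P (Sum.elim x w) :=
    fun x => ⟨Classical.epsilon _, fun hx => Classical.epsilon_spec hx⟩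
  choose w hw using hw
  obtain ⟨c, hc, hcX⟩ := hF ((fun x => Sum.elim x (w x)) '' (F ∩ {x | ∃ w, P (Sum.elim x w)}))
    ((h1.subset Set.inter_subset_left).image _) (by
      rintro _ ⟨x, ⟨-, hx⟩, rfl⟩
      exact hw x hx)
  refine ⟨c, fun x hx => ⟨?_, fun h => ?_⟩⟩
  · rintro ⟨y, hy⟩
    rw [key] at hy
    exact ⟨y, hcX _ hy⟩
  · refine ⟨w x, ?_⟩
    rw [key]
    exact hc _ ⟨x, ⟨hx, h⟩, rfl⟩

theorem forall_tuple (hM : StructureNIP L M) [Finite α] [Finite β] {P : (α ⊕ β → M) → Prop}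
    (h : Approximable L {v | P v}) :
    Approximable L {v : α → M | ∀ w : β → M, P (Sum.elim v w)} := by
  have := (h.not.exists_tuple hM).not
  simpa using this

end Approximable

/-- A set that is the trace of a definable set of an elementary extension agrees with definable
sets of the same family on finite sets, by elementarity. -/
theorem ExternallyDefinable.approximable {n : ℕ} {X : Set (Fin n → M)}
    (h : ExternallyDefinable L X) : Approximable L X := by
  obtain ⟨N, _, j, Y, hY, rfl⟩ := h
  obtain ⟨p, d, φ, hφ⟩ := hY.paramDefinable.exists_finite_parameters
  refine ⟨Fin p, inferInstance, fun v => φ.Realize v,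
    JointlyDefinable.of_parameterFree_formula φ, fun F hF => ?_⟩
  have : Finite F := hF
  have key : JointlyDefinable L (Empty.elim : Empty → M) (fun k => j (Empty.elim k))
      (fun v : F × Fin n → M => ∃ c : Fin p → M, ∀ x : F,
        φ.Realize (fun k => Sum.elim v c (Sum.map (fun t => (x, t)) id k)) ↔
          (fun i => j (x.1 i)) ∈ Y)
      (fun v : F × Fin n → N => ∃ c : Fin p → N, ∀ x : F,
        φ.Realize (fun k => Sum.elim v c (Sum.map (fun t => (x, t)) id k)) ↔
          (fun i => j (x.1 i)) ∈ Y) :=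
    JointlyDefinable.exists_tuple (JointlyDefinable.forall_index fun x =>
      ((JointlyDefinable.of_parameterFree_formula φ).comp _).iff (JointlyDefinable.const _))
  obtain ⟨c, hc⟩ := (key.elementary_iff j (fun q => q.1.1 q.2)).1 ⟨d, fun x => by
    rw [← hφ]
    refine iff_of_eq (congrArg _ ?_)
    funext k
    cases k <;> rfl⟩
  refine ⟨c, fun x hx => Iff.trans (iff_of_eq (congrArg _ ?_)) (hc ⟨x, hx⟩)⟩
  funext k
  cases k <;> rfl

/-- Shelah's expansion has no new terms. -/
theorem exists_term_realize_eq {α : Type*} (t : (extLanguage L M).Term α) :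
    ∃ t' : L.Term α, ∀ v : α → M, t'.realize v = t.realize v := by
  induction t with
  | var i => exact ⟨Term.var i, fun _ => rfl⟩
  | func f ts ih =>
    choose ts' hts' using ih
    rcases f with f | f
    · exact ⟨Term.func f ts', fun v => by
        simp only [Term.realize, hts']
        rfl⟩
    · exact f.elim

/-- In a NIP structure, every formula of the language of Shelah's expansion defines an externally
definable set. -/
theorem approximable_extLanguage_boundedFormula (hM : StructureNIP L M) {α : Type} [Finite α]
    {m : ℕ} (ψ : (extLanguage L M).BoundedFormula α m) :
    Approximable L {v : α ⊕ Fin m → M |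
      ψ.Realize (fun i => v (Sum.inl i)) (fun i => v (Sum.inr i))} := by
  induction ψ with
  | falsum => exact Approximable.of_paramDefinable (JointlyDefinable.const False)
  | @equal m t₁ t₂ =>
    obtain ⟨t₁', h₁⟩ := exists_term_realize_eq t₁
    obtain ⟨t₂', h₂⟩ := exists_term_realize_eq t₂
    have := Approximable.of_paramDefinable ((JointlyDefinable.eq_var (L := L) (a := (id : M → M))
      (b := (id : M → M)) (α := Fin 2) 0 1).subst ![t₁', t₂'])
    simp only [Matrix.cons_val_zero, Matrix.cons_val_one, h₁, h₂] at this
    convert this using 3 with v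
    simp only [BoundedFormula.Realize]
    rw [show Sum.elim (fun i => v (Sum.inl i)) (fun i => v (Sum.inr i)) = v from
      Sum.elim_comp_inl_inr v]
  | @rel m l R ts =>
    choose ts' hts' using fun i => exists_term_realize_eq (ts i)
    have hR : Approximable L {x : Fin l → M | Structure.RelMap R x} := by
      rcases R with R | R
      · refine Approximable.of_paramDefinable ((JointlyDefinable.of_parameterFree_formula
          (R.formula (fun i : Fin l => Term.var i))).congr (fun v => ?_) (fun v => ?_))
        all_goals
          rw [Formula.realize_rel]
          rfl
      · exact ExternallyDefinable.approximable R.2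
    have := hR.subst ts'
    simp only [hts'] at this
    convert this using 3 with v
    simp only [BoundedFormula.Realize]
    rw [show Sum.elim (fun i => v (Sum.inl i)) (fun i => v (Sum.inr i)) = v from
      Sum.elim_comp_inl_inr v]
  | imp _ _ ih₁ ih₂ => exact ih₁.imp ih₂
  | @all m ψ ih =>
    have h := (ih.comp (β := (α ⊕ Fin m) ⊕ Fin 1) (Sum.elim (fun i => Sum.inl (Sum.inl i))
      (Fin.snoc (fun i => Sum.inl (Sum.inr i)) (Sum.inr 0)))).forall_tuple hM
    convert h using 3 with v
    rw [BoundedFormula.realize_all, ← (Equiv.funUnique (Fin 1) M).forall_congr_right]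
    refine forall_congr' fun w => iff_of_eq (congrArg _ ?_)
    funext i
    refine Fin.lastCases ?_ (fun i => ?_) i <;> simp [Equiv.funUnique]

theorem approximable_extLanguage_formula (hM : StructureNIP L M) {α : Type} [Finite α]
    (ψ : (extLanguage L M).Formula α) : Approximable L {v : α → M | ψ.Realize v} := by
  have h := (approximable_extLanguage_boundedFormula hM ψ).comp (Sum.elim id Fin.elim0)
  convert h using 3 with v
  exact iff_of_eq (congrArg (BoundedFormula.Realize ψ v) (Subsingleton.elim _ _))

end NIPGroup

namespace NIPGroup

/-! ### Subgroups of bounded index -/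

variable {Γ : Type*} [Group Γ]

/-- On the set `F`, the predicate `S` looks like a subgroup of index at most `k`. -/
def SubgroupLikeOn (k : ℕ) (F : Set Γ) (S : Γ → Prop) : Prop :=
  (∀ x ∈ F, ∀ y ∈ F, S x → S y → S (x * y⁻¹)) ∧
    ∀ a : Fin (k + 1) → Γ, (∀ i, a i ∈ F) → ∃ i j, i ≠ j ∧ S ((a i)⁻¹ * a j)

theorem SubgroupLikeOn.exists_subgroup {k : ℕ} {S : Γ → Prop}
    (h : SubgroupLikeOn k Set.univ S) :
    ∃ H : Subgroup Γ, (∀ x, x ∈ H ↔ S x) ∧ H.index ≠ 0 ∧ H.index ≤ k := by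
  have h1 : S 1 := by
    obtain ⟨i, j, -, hij⟩ := h.2 (fun _ => 1) (fun _ => Set.mem_univ _)
    simpa using hij
  have hinv : ∀ x, S x → S x⁻¹ := fun x hx => by
    simpa using h.1 1 (Set.mem_univ _) x (Set.mem_univ _) h1 hx
  let H : Subgroup Γ :=
    { carrier := {x | S x}
      one_mem' := h1
      mul_mem' := fun {x y} hx hy => by
        simpa using h.1 x (Set.mem_univ _) y⁻¹ (Set.mem_univ _) hx (hinv y hy)
      inv_mem' := fun {x} hx => hinv x hx }
  have hinj : ∀ q : Fin (k + 1) → Γ ⧸ H, ¬ Function.Injective q := fun q hq => by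
    obtain ⟨i, j, hij, hS⟩ := h.2 (fun i => (q i).out) (fun _ => Set.mem_univ _)
    refine hij (hq ?_)
    rw [← (q i).out_eq', ← (q j).out_eq']
    exact QuotientGroup.eq.2 hS
  have hfin : Finite (Γ ⧸ H) := by
    by_contra hinf
    have : Infinite (Γ ⧸ H) := not_finite_iff_infinite.1 hinf
    exact hinj (fun i => Infinite.natEmbedding _ (i : ℕ))
      ((Infinite.natEmbedding _).injective.comp Fin.val_injective)
  refine ⟨H, fun _ => Iff.rfl, (Subgroup.finiteIndex_iff_finite_quotient.2 hfin).index_ne_zero, ?_⟩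
  by_contra hk
  push Not at hk
  exact hinj (fun i => (Finite.equivFin (Γ ⧸ H)).symm (Fin.castLE hk i))
    ((Equiv.injective _).comp (Fin.castLE_injective _))

theorem SubgroupLikeOn.of_subgroup {k : ℕ} (H : Subgroup Γ) (h0 : H.index ≠ 0) (hk : H.index ≤ k)
    (F : Set Γ) : SubgroupLikeOn k F (fun x => x ∈ H) := by
  refine ⟨fun x _ y _ hx hy => H.mul_mem hx (H.inv_mem hy), fun a _ => ?_⟩
  have : H.FiniteIndex := ⟨h0⟩
  have : Fintype (Γ ⧸ H) := Fintype.ofFinite _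
  obtain ⟨i, j, hij, he⟩ := Fintype.exists_ne_map_eq_of_card_lt (fun i => (a i : Γ ⧸ H)) (by
    rw [Fintype.card_fin, ← Nat.card_eq_fintype_card]
    exact Nat.lt_succ_of_le hk)
  exact ⟨i, j, hij, QuotientGroup.eq.1 he⟩

/-! ### The Baldwin-Saxl lemma -/

section BaldwinSaxl

variable {ι : Type*} (K : ι → Subgroup Γ)

/-- If no `K i` contains the intersection of the others, then the products of the witnesses
of this realize all patterns of membership. -/
theorem exists_mem_iff_notMem_of_independent [DecidableEq ι] {s : Finset ι}
    (h : ∀ i ∈ s, ∃ b, b ∉ K i ∧ ∀ j ∈ s, j ≠ i → b ∈ K j) (J : Finset ι) (hJ : J ⊆ s) :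
    ∃ g : Γ, ∀ i ∈ s, g ∈ K i ↔ i ∉ J := by
  induction J using Finset.induction_on with
  | empty => exact ⟨1, fun i _ => by simp [(K i).one_mem]⟩
  | insert i₀ J hi₀ ih =>
    obtain ⟨g, hg⟩ := ih ((Finset.subset_insert _ _).trans hJ)
    obtain ⟨b, hb, hb'⟩ := h i₀ (hJ (Finset.mem_insert_self _ _))
    refine ⟨b * g, fun i hi => ?_⟩
    by_cases hii : i = i₀
    · subst hii
      rw [(K i).mul_mem_cancel_right ((hg i hi).2 hi₀)]
      simp [hb]
    · rw [(K i).mul_mem_cancel_left (hb' i hi hii), hg i hi]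
      simp [hii]

theorem index_biInf_bound {k : ℕ} (h0 : ∀ i, (K i).index ≠ 0) (hk : ∀ i, (K i).index ≤ k)
    (s : Finset ι) : (⨅ i ∈ s, K i).index ≠ 0 ∧ (⨅ i ∈ s, K i).index ≤ k ^ s.card := by
  classical
  induction s using Finset.induction_on with
  | empty => simp
  | insert i s hi ih =>
    rw [Finset.iInf_insert, Finset.card_insert_of_notMem hi, pow_succ']
    exact ⟨Subgroup.index_inf_ne_zero (h0 i) ih.1,
      (Subgroup.index_inf_le).trans (Nat.mul_le_mul (hk i) ih.2)⟩

theorem exists_small_subset_biInf_eq {l : ℕ}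
    (hl : ∀ a : Fin l → ι, ¬ ∀ S : Set (Fin l), ∃ g, ∀ i, g ∈ K (a i) ↔ i ∈ S)
    (s : Finset ι) :
    ∃ s' : Finset ι, s'.card ≤ l ∧ ⨅ i ∈ s', K i = ⨅ i ∈ s, K i := by
  classical
  induction hn : s.card generalizing s with
  | zero => exact ⟨s, by omega, rfl⟩
  | succ n ih =>
    by_cases hc : s.card ≤ l
    · exact ⟨s, hc, rfl⟩
    have hex : ∃ i ∈ s, ⨅ j ∈ s.erase i, K j ≤ K i := by
      by_contra hcon
      push Not at hcon
      have hind : ∀ i ∈ s, ∃ b, b ∉ K i ∧ ∀ j ∈ s, j ≠ i → b ∈ K j := fun i hi => by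
        obtain ⟨b, hb, hb'⟩ := SetLike.not_le_iff_exists.1 (hcon i hi)
        refine ⟨b, hb', fun j hj hji => ?_⟩
        simp only [Subgroup.mem_iInf] at hb
        exact hb j (Finset.mem_erase.2 ⟨hji, hj⟩)
      let a : Fin l → ι := fun i => (s.equivFin.symm (Fin.castLE (by omega) i) : ι)
      have ha : Function.Injective a := Subtype.val_injective.comp
        ((Equiv.injective _).comp (Fin.castLE_injective _))
      refine hl a fun S => ?_
      obtain ⟨g, hg⟩ := exists_mem_iff_notMem_of_independent K hind
        (s.filter fun i => ∃ t, t ∉ S ∧ a t = i) (Finset.filter_subset _ _)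
      refine ⟨g, fun i => ?_⟩
      have hi : a i ∈ s := Subtype.prop _
      rw [hg _ hi, Finset.mem_filter]
      constructor
      · intro h
        by_contra hS
        exact h ⟨hi, i, hS, rfl⟩
      · rintro hS ⟨-, t, ht, hti⟩
        exact ht (ha hti ▸ hS)
    obtain ⟨i, hi, hle⟩ := hex
    obtain ⟨s', hs', he⟩ := ih (s.erase i) (by rw [Finset.card_erase_of_mem hi]; omega)
    refine ⟨s', hs', he.trans ?_⟩
    conv_rhs => rw [← Finset.insert_erase hi, Finset.iInf_insert]
    exact (inf_eq_right.2 hle).symm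

/-- The Baldwin-Saxl lemma: if a family of subgroups of bounded index shatters no `l` of its
members, then its intersection is a finite intersection, of bounded index. -/
theorem exists_finset_iInf_eq {l : ℕ}
    (hl : ∀ a : Fin l → ι, ¬ ∀ S : Set (Fin l), ∃ g, ∀ i, g ∈ K (a i) ↔ i ∈ S)
    {k : ℕ} (hk1 : 1 ≤ k) (h0 : ∀ i, (K i).index ≠ 0) (hk : ∀ i, (K i).index ≤ k) :
    ∃ s : Finset ι, ⨅ i, K i = ⨅ i ∈ s, K i ∧ (⨅ i, K i).index ≠ 0 ∧
      (⨅ i, K i).index ≤ k ^ l := by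
  classical
  have hb : ∀ s : Finset ι, (⨅ i ∈ s, K i).index ≤ k ^ l := fun s => by
    obtain ⟨s', hs', he⟩ := exists_small_subset_biInf_eq K hl s
    rw [← he]
    exact (index_biInf_bound K h0 hk s').2.trans (Nat.pow_le_pow_right hk1 hs')
  -- a finite intersection of maximal index is contained in every member
  let s : Finset ι := Function.argmin fun s : Finset ι => k ^ l - (⨅ i ∈ s, K i).index
  have hs : ∀ s' : Finset ι, (⨅ i ∈ s', K i).index ≤ (⨅ i ∈ s, K i).index := fun s' => by
    have h1 : k ^ l - (⨅ i ∈ s, K i).index ≤ k ^ l - (⨅ i ∈ s', K i).index :=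
      Function.argmin_le (fun s : Finset ι => k ^ l - (⨅ i ∈ s, K i).index) s'
    have h2 := hb s'
    have h3 := hb s
    omega
  have heq : ⨅ i, K i = ⨅ i ∈ s, K i := by
    refine le_antisymm (le_iInf fun i => le_iInf fun _ => iInf_le _ i) (le_iInf fun i => ?_)
    by_contra hle
    have hlt : ⨅ j ∈ insert i s, K j < ⨅ j ∈ s, K j := by
      rw [Finset.iInf_insert]
      exact inf_lt_right.2 fun h => hle h
    have : (⨅ j ∈ insert i s, K j).FiniteIndex := ⟨(index_biInf_bound K h0 hk _).1⟩
    exact (hs (insert i s)).not_gt (Subgroup.index_strictAnti hlt)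
  exact ⟨s, heq, heq ▸ (index_biInf_bound K h0 hk s).1, heq ▸ hb s⟩

theorem card_le_of_le_subgroup [Finite ι] (hK : Function.Injective K) (H : Subgroup Γ)
    (h0 : H.index ≠ 0) (hle : ∀ i, H ≤ K i) : Nat.card ι ≤ 2 ^ H.index := by
  have : H.FiniteIndex := ⟨h0⟩
  have : Fintype (Γ ⧸ H) := Fintype.ofFinite _
  have hcard : Nat.card (Set (Γ ⧸ H)) = 2 ^ H.index := by
    rw [Nat.card_eq_fintype_card, Fintype.card_set, Subgroup.index, Nat.card_eq_fintype_card]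
  rw [← hcard]
  refine Nat.card_le_card_of_injective
    (fun i => (QuotientGroup.mk '' (K i : Set Γ) : Set (Γ ⧸ H))) fun i j hij => hK ?_
  have key : ∀ i j, (QuotientGroup.mk '' (K i : Set Γ) : Set (Γ ⧸ H)) =
      QuotientGroup.mk '' (K j : Set Γ) → K i ≤ K j := fun i j hij x hx => by
    obtain ⟨y, hy, hyx⟩ : (x : Γ ⧸ H) ∈ (QuotientGroup.mk '' (K j : Set Γ) : Set (Γ ⧸ H)) :=
      hij ▸ ⟨x, hx, rfl⟩
    have := (K j).mul_mem hy (hle j (QuotientGroup.eq.1 hyx))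
    simpa using this
  exact le_antisymm (key i j hij) (key j i hij.symm)

end BaldwinSaxl

end NIPGroup

namespace NIPGroup

/-! ### Uniform definability of approximable subgroups of finite index -/

section Approximation

variable {Γ C : Type*} [Group Γ] (φ : Γ → C → Prop)

/-- There are `r` members of the family `φ` that look like subgroups of index at most `k` on the
points `f₁` and have pairwise different traces on the points `f₀`. -/
def HasTraces (k r : ℕ) {t s : ℕ} (f₀ : Fin t → Γ) (f₁ : Fin s → Γ) : Prop :=
  ∃ c : Fin r → C, (∀ i, SubgroupLikeOn k (Set.range f₁) (fun x => φ x (c i))) ∧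
    ∀ i j, i ≠ j → ∃ x, ¬ (φ (f₀ x) (c i) ↔ φ (f₀ x) (c j))

variable {φ}

/-- For `t` points `f₀` there are boundedly many points `f₁` such that the number of traces on `f₀`
has a bound that does not depend on `t`. Otherwise a limit of counterexamples, along an ultrafilter
on the finite sets of words in `t` letters, would give too many subgroups of bounded index of
a free group, in contradiction with the Baldwin-Saxl lemma. -/
theorem exists_not_hasTraces {l : ℕ}
    (hl : ∀ a : Fin l → C, ¬ ∀ S : Set (Fin l), ∃ g, ∀ i, φ g (a i) ↔ i ∈ S) {k : ℕ} (hk : 1 ≤ k)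
    (t : ℕ) : ∃ s : ℕ, ∀ f₀ : Fin t → Γ, ∃ f₁ : Fin s → Γ,
      ¬ HasTraces φ k (2 ^ (k ^ l) + 1) f₀ f₁ := by
  classical
  by_contra hcon
  push Not at hcon
  have hW : ∀ W : Finset (FreeGroup (Fin t)), ∃ (f : Fin t → Γ) (c : Fin (2 ^ (k ^ l) + 1) → C),
      (∀ i, SubgroupLikeOn k (FreeGroup.lift f '' (W : Set (FreeGroup (Fin t))))
        (fun x => φ x (c i))) ∧
      ∀ i j, i ≠ j → ∃ x, ¬ (φ (f x) (c i) ↔ φ (f x) (c j)) := by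
    intro W
    obtain ⟨f, hf⟩ := hcon W.card
    obtain ⟨c, hc, hd⟩ := hf (fun i => FreeGroup.lift f (W.equivFin.symm i))
    refine ⟨f, c, fun i => ?_, hd⟩
    convert hc i using 1
    ext x
    constructor
    · rintro ⟨w, hw, rfl⟩
      exact ⟨W.equivFin ⟨w, hw⟩, by simp⟩
    · rintro ⟨i, rfl⟩
      exact ⟨_, (W.equivFin.symm i).2, rfl⟩
  choose f c hc hd using hW
  let U : Ultrafilter (Finset (FreeGroup (Fin t))) := Ultrafilter.of Filter.atTop
  have hU : ∀ w : FreeGroup (Fin t), ∀ᶠ W in (U : Filter (Finset (FreeGroup (Fin t)))), w ∈ W :=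
    fun w => (Filter.eventually_ge_atTop ({w} : Finset _)).filter_mono (Ultrafilter.of_le _) |>.mono
      fun W hw => hw (Finset.mem_singleton_self w)
  have hP : ∀ i, SubgroupLikeOn k Set.univ (fun w => ∀ᶠ W in
      (U : Filter (Finset (FreeGroup (Fin t)))), φ (FreeGroup.lift (f W) w) (c W i)) := by
    intro i
    refine ⟨fun x _ y _ hx hy => ?_, fun a _ => ?_⟩
    · filter_upwards [hx, hy, hU x, hU y] with W h1 h2 h3 h4
      rw [map_mul, map_inv]
      exact (hc W i).1 _ ⟨x, h3, rfl⟩ _ ⟨y, h4, rfl⟩ h1 h2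
    · by_contra hno
      push Not at hno
      have h1 : ∀ᶠ W in (U : Filter (Finset (FreeGroup (Fin t)))), ∀ i' j, i' ≠ j →
          ¬ φ (FreeGroup.lift (f W) ((a i')⁻¹ * a j)) (c W i) := by
        refine Filter.eventually_all.2 fun i' => Filter.eventually_all.2 fun j => ?_
        by_cases hij : i' = j
        · exact Filter.Eventually.of_forall fun W h => (h hij).elim
        · exact (hno i' j hij).mono fun W h _ => h
      obtain ⟨W, hW1, hW2⟩ := (h1.and (Filter.eventually_all.2 fun i' => hU (a i'))).exists
      obtain ⟨i', j, hij, hφ⟩ := (hc W i).2 (fun i' => FreeGroup.lift (f W) (a i'))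
        (fun i' => ⟨_, hW2 i', rfl⟩)
      refine hW1 i' j hij ?_
      rw [map_mul, map_inv]
      exact hφ
  choose H hH hH0 hHk using fun i => (hP i).exists_subgroup
  have hinj : Function.Injective H := by
    intro i j hij
    by_contra hne
    have h1 : ∀ᶠ W in (U : Filter (Finset (FreeGroup (Fin t)))), ∀ x : Fin t,
        (φ (f W x) (c W i) ↔ φ (f W x) (c W j)) := by
      refine Filter.eventually_all.2 fun x => ?_
      have hx : FreeGroup.of x ∈ H i ↔ FreeGroup.of x ∈ H j := by rw [hij]
      rw [hH, hH] at hx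
      simp only [FreeGroup.lift_apply_of] at hx
      by_cases hxi : ∀ᶠ W in (U : Filter (Finset (FreeGroup (Fin t)))), φ (f W x) (c W i)
      · filter_upwards [hxi, hx.1 hxi] with W h1 h2
        exact iff_of_true h1 h2
      · filter_upwards [Ultrafilter.eventually_not.2 hxi,
          Ultrafilter.eventually_not.2 fun h => hxi (hx.2 h)] with W h1 h2
        exact iff_of_false h1 h2
    obtain ⟨W, hW⟩ := h1.exists
    obtain ⟨x, hx⟩ := hd W i j hne
    exact hx (hW x)
  have hshatter : ∀ a : Fin l → Fin (2 ^ (k ^ l) + 1), ¬ ∀ S : Set (Fin l), ∃ g, ∀ i,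
      g ∈ H (a i) ↔ i ∈ S := by
    intro a ha
    choose g hg using ha
    have h1 : ∀ᶠ W in (U : Filter (Finset (FreeGroup (Fin t)))), ∀ (S : Set (Fin l)) (i : Fin l),
        φ (FreeGroup.lift (f W) (g S)) (c W (a i)) ↔ i ∈ S := by
      refine Filter.eventually_all.2 fun S => Filter.eventually_all.2 fun i => ?_
      have h2 := hg S i
      rw [hH] at h2
      by_cases hi : i ∈ S
      · exact (h2.2 hi).mono fun W h => iff_of_true h hi
      · exact (Ultrafilter.eventually_not.2 fun h => hi (h2.1 h)).mono
          fun W h => iff_of_false h hi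
    obtain ⟨W, hW⟩ := h1.exists
    exact hl (fun i => c W (a i)) fun S => ⟨_, hW S⟩
  obtain ⟨-, -, h0, hle⟩ := exists_finset_iInf_eq H hshatter hk hH0 hHk
  have h1 := card_le_of_le_subgroup H hinj _ h0 (fun i => iInf_le _ i)
  rw [Nat.card_eq_fintype_card, Fintype.card_fin] at h1
  have h2 : 2 ^ (⨅ i, H i).index ≤ 2 ^ (k ^ l) := Nat.pow_le_pow_right (by norm_num) hle
  omega

/-- A subgroup of finite index that agrees on finite sets with members of the family `φ`, of finite
Vapnik-Chervonenkis dimension, is obtained from `φ` by quantification over bounded tuples.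
The points `f₀` are chosen so that the number of their traces is as large as possible. Then
for each further point `g` there are boundedly many points such that a member of `φ` that
looks like a subgroup on those points is determined at `g` by its trace on `f₀`. -/
theorem exists_mem_iff_of_agree_on_finite (hφ : FiniteVC (fun (c : C) (g : Γ) => φ g c)) {k : ℕ}
    (H : Subgroup Γ) (h0 : H.index ≠ 0) (hk : H.index ≤ k)
    (hH : ∀ F : Set Γ, F.Finite → ∃ c, ∀ x ∈ F, φ x c ↔ x ∈ H) :
    ∃ (t s : ℕ) (f₀ : Fin t → Γ), ∀ g, g ∈ H ↔ ∃ f₁ : Fin s → Γ, ∀ c,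
      SubgroupLikeOn k (Set.range f₁) (fun x => φ x c) → (∀ i, φ (f₀ i) c ↔ f₀ i ∈ H) → φ g c := by
  obtain ⟨l, hl⟩ := hφ
  have hk1 : 1 ≤ k := (Nat.one_le_iff_ne_zero.2 h0).trans hk
  let A : ℕ → Prop := fun r => ∃ t, ∀ s, ∃ f₀ : Fin t → Γ, ∀ f₁ : Fin s → Γ, HasTraces φ k r f₀ f₁
  have hA0 : A 0 := ⟨0, fun s => ⟨Fin.elim0, fun f₁ => ⟨Fin.elim0, fun i => i.elim0,
    fun i => i.elim0⟩⟩⟩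
  have hAN : ¬ A (2 ^ (k ^ l) + 1) := by
    rintro ⟨t, ht⟩
    obtain ⟨s, hs⟩ := exists_not_hasTraces hl hk1 t
    obtain ⟨f₀, hf₀⟩ := ht s
    obtain ⟨f₁, hf₁⟩ := hs f₀
    exact hf₁ (hf₀ f₁)
  obtain ⟨r, ⟨t, ht⟩, hr⟩ : ∃ r, A r ∧ ¬ A (r + 1) := by
    by_contra hcon
    push Not at hcon
    exact hAN (Nat.rec (motive := A) hA0 hcon _)
  obtain ⟨s, hs⟩ : ∃ s, ∀ f₀ : Fin (t + 1) → Γ, ∃ f₁ : Fin s → Γ,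
      ¬ HasTraces φ k (r + 1) f₀ f₁ := by
    by_contra hcon
    push Not at hcon
    exact hr ⟨t + 1, hcon⟩
  obtain ⟨f₀, hf₀⟩ := ht s
  -- `H` agrees on `f₀`, `f₁` and `g` with a member of the family that looks like a subgroup on `f₁`
  have hc : ∀ (f₁ : Fin s → Γ) (g : Γ), ∃ c, SubgroupLikeOn k (Set.range f₁) (fun x => φ x c) ∧
      (∀ i, φ (f₀ i) c ↔ f₀ i ∈ H) ∧ (φ g c ↔ g ∈ H) := by
    intro f₁ g
    obtain ⟨c, hc⟩ := hH (({g} ∪ Set.range f₀) ∪ (Set.range f₁ ∪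
      (Set.range (fun p : Fin s × Fin s => f₁ p.1 * (f₁ p.2)⁻¹) ∪
        Set.range (fun p : Fin s × Fin s => (f₁ p.1)⁻¹ * f₁ p.2))))
      (((Set.finite_singleton g).union (Set.finite_range _)).union ((Set.finite_range _).union
        ((Set.finite_range _).union (Set.finite_range _))))
    have hsub := SubgroupLikeOn.of_subgroup H h0 hk (Set.range f₁)
    refine ⟨c, ⟨?_, fun a ha => ?_⟩,
      fun i => hc _ (Or.inl (Or.inr ⟨i, rfl⟩)), hc _ (Or.inl (Or.inl rfl))⟩
    · rintro _ ⟨i, rfl⟩ _ ⟨j, rfl⟩ hx hy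
      rw [hc _ (Or.inr (Or.inl ⟨_, rfl⟩))] at hx hy
      rw [hc _ (Or.inr (Or.inr (Or.inl ⟨(i, j), rfl⟩)))]
      exact hsub.1 _ ⟨i, rfl⟩ _ ⟨j, rfl⟩ hx hy
    · obtain ⟨i, j, hij, h⟩ := hsub.2 a ha
      obtain ⟨i', hi'⟩ := ha i
      obtain ⟨j', hj'⟩ := ha j
      exact ⟨i, j, hij, (hc _ (Or.inr (Or.inr (Or.inr ⟨(i', j'), by simp [hi', hj']⟩)))).2 h⟩
  refine ⟨t, s, f₀, fun g => ⟨fun hg => ?_, ?_⟩⟩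
  · obtain ⟨f₁, hf₁⟩ := hs (Fin.cons g f₀)
    obtain ⟨d, hd, hdne⟩ := hf₀ f₁
    -- there are no more traces on `g` and `f₀` than on `f₀`
    have key : ∀ c, SubgroupLikeOn k (Set.range f₁) (fun x => φ x c) → ∃ i : Fin r,
        (φ g c ↔ φ g (d i)) ∧ ∀ x, φ (f₀ x) c ↔ φ (f₀ x) (d i) := by
      intro c hc
      by_contra hcon
      have hcon' : ∀ i : Fin r, ∃ x : Fin (t + 1), ¬ (φ ((Fin.cons g f₀ : Fin (t + 1) → Γ) x) c ↔
          φ ((Fin.cons g f₀ : Fin (t + 1) → Γ) x) (d i)) := by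
        intro i
        by_contra hi
        push Not at hi
        exact hcon ⟨i, hi 0, fun x => by simpa using hi x.succ⟩
      refine hf₁ ⟨Fin.cons c d, Fin.cases hc hd, ?_⟩
      refine Fin.cases (Fin.cases (fun h => (h rfl).elim) fun j _ => ?_)
        fun i => Fin.cases (fun _ => ?_) fun j hij => ?_
      · simpa using hcon' j
      · obtain ⟨x, hx⟩ := hcon' i
        exact ⟨x, fun h => hx h.symm⟩
      · obtain ⟨x, hx⟩ := hdne i j fun h => hij (congrArg _ h)
        exact ⟨x.succ, by simpa using hx⟩
    obtain ⟨c', hc'1, hc'2, hc'3⟩ := hc f₁ g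
    refine ⟨f₁, fun c hc1 hc2 => ?_⟩
    obtain ⟨i, hi1, hi2⟩ := key c hc1
    obtain ⟨i', hi'1, hi'2⟩ := key c' hc'1
    have hii : i = i' := by
      by_contra hne
      obtain ⟨x, hx⟩ := hdne i i' hne
      exact hx ((hi2 x).symm.trans ((hc2 x).trans ((hc'2 x).symm.trans (hi'2 x))))
    subst hii
    exact hi1.2 (hi'1.1 (hc'3.2 hg))
  · rintro ⟨f₁, hf₁⟩
    obtain ⟨c, hc1, hc2, hc3⟩ := hc f₁ g
    exact hc3.1 (hf₁ c hc1 hc2)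

end Approximation

end NIPGroup

namespace NIPGroup

/-! ### Subgroups of definable groups -/

namespace JointlyDefinable

variable {L : FirstOrder.Language.{u, v}} {M : Type w} {N : Type w'} [L.Structure M]
  [L.Structure N] {κ : Type*} {a : κ → M} {b : κ → N} {α β γ : Type*}

theorem forall_curried [Finite β] {P : (α → M) → (β → M) → Prop} {Q : (α → N) → (β → N) → Prop}
    (h : JointlyDefinable L a b
      (fun u : α ⊕ β → M => P (fun i => u (Sum.inl i)) (fun i => u (Sum.inr i)))
      (fun u => Q (fun i => u (Sum.inl i)) (fun i => u (Sum.inr i)))) :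
    JointlyDefinable L a b (fun v => ∀ w, P v w) (fun v => ∀ w, Q v w) :=
  h.forall_tuple

theorem exists_curried [Finite β] {P : (α → M) → (β → M) → Prop} {Q : (α → N) → (β → N) → Prop}
    (h : JointlyDefinable L a b
      (fun u : α ⊕ β → M => P (fun i => u (Sum.inl i)) (fun i => u (Sum.inr i)))
      (fun u => Q (fun i => u (Sum.inl i)) (fun i => u (Sum.inr i)))) :
    JointlyDefinable L a b (fun v => ∃ w, P v w) (fun v => ∃ w, Q v w) :=
  h.exists_tuple

theorem forall_family {ι : Type*} [Finite ι] [Finite β] {P : (α → M) → (ι → β → M) → Prop}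
    {Q : (α → N) → (ι → β → N) → Prop}
    (h : JointlyDefinable L a b
      (fun u : α ⊕ ι × β → M => P (fun i => u (Sum.inl i)) (fun i t => u (Sum.inr (i, t))))
      (fun u => Q (fun i => u (Sum.inl i)) (fun i t => u (Sum.inr (i, t))))) :
    JointlyDefinable L a b (fun v => ∀ w, P v w) (fun v => ∀ w, Q v w) :=
  h.forall_tuple.congr (fun _ => ⟨fun h w => h (fun p => w p.1 p.2), fun h _ => h _⟩)
    (fun _ => ⟨fun h w => h (fun p => w p.1 p.2), fun h _ => h _⟩)

theorem exists_family {ι : Type*} [Finite ι] [Finite β] {P : (α → M) → (ι → β → M) → Prop}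
    {Q : (α → N) → (ι → β → N) → Prop}
    (h : JointlyDefinable L a b
      (fun u : α ⊕ ι × β → M => P (fun i => u (Sum.inl i)) (fun i t => u (Sum.inr (i, t))))
      (fun u => Q (fun i => u (Sum.inl i)) (fun i t => u (Sum.inr (i, t))))) :
    JointlyDefinable L a b (fun v => ∃ w, P v w) (fun v => ∃ w, Q v w) :=
  h.exists_tuple.congr (fun _ => ⟨fun ⟨_, h⟩ => ⟨_, h⟩, fun ⟨w, h⟩ => ⟨fun p => w p.1 p.2, h⟩⟩)
    (fun _ => ⟨fun ⟨_, h⟩ => ⟨_, h⟩, fun ⟨w, h⟩ => ⟨fun p => w p.1 p.2, h⟩⟩)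

theorem apply_curried {P : (α → M) → (β → M) → Prop} {Q : (α → N) → (β → N) → Prop}
    (h : JointlyDefinable L a b
      (fun u : α ⊕ β → M => P (fun i => u (Sum.inl i)) (fun i => u (Sum.inr i)))
      (fun u => Q (fun i => u (Sum.inl i)) (fun i => u (Sum.inr i)))) (p : α → γ) (x : β → γ) :
    JointlyDefinable L a b (fun v : γ → M => P (fun i => v (p i)) (fun i => v (x i)))
      (fun v => Q (fun i => v (p i)) (fun i => v (x i))) :=
  h.comp (Sum.elim p x)

end JointlyDefinable

/-- For a group `G ⊆ V` whose operation has the graph `P`: on the set `F`, the predicate `S` looks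
like a subgroup of index at most `k`. -/
def GraphSubgroupLikeOn {V : Type*} (G : V → Prop) (P : V → V → V → Prop) (k : ℕ)
    (F S : V → Prop) : Prop :=
  (∀ x y z, F x → F y → S x → S y → G z → P z y x → S z) ∧
    ∀ a : Fin (k + 1) → V, (∀ i, F (a i)) → ∃ i j, i ≠ j ∧ ∃ z, G z ∧ P (a i) z (a j) ∧ S z

section

variable {L : FirstOrder.Language.{u, v}} {M : Type w} {N : Type w'} [L.Structure M]
  [L.Structure N]

theorem JointlyDefinable.graphSubgroupLikeOn {κ : Type*} {a : κ → M} {b : κ → N} {α : Type*}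
    {n : ℕ} {G : (Fin n → M) → Prop} {G' : (Fin n → N) → Prop}
    {P : (Fin n → M) → (Fin n → M) → (Fin n → M) → Prop}
    {P' : (Fin n → N) → (Fin n → N) → (Fin n → N) → Prop}
    {F S : (α → M) → (Fin n → M) → Prop} {F' S' : (α → N) → (Fin n → N) → Prop}
    (hG : JointlyDefinable L a b G G')
    (hP : JointlyDefinable L a b
      (fun u : Fin 3 × Fin n → M => P (fun t => u (0, t)) (fun t => u (1, t)) (fun t => u (2, t)))
      (fun u => P' (fun t => u (0, t)) (fun t => u (1, t)) (fun t => u (2, t))))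
    (hF : JointlyDefinable L a b
      (fun u : α ⊕ Fin n → M => F (fun i => u (Sum.inl i)) (fun i => u (Sum.inr i)))
      (fun u => F' (fun i => u (Sum.inl i)) (fun i => u (Sum.inr i))))
    (hS : JointlyDefinable L a b
      (fun u : α ⊕ Fin n → M => S (fun i => u (Sum.inl i)) (fun i => u (Sum.inr i)))
      (fun u => S' (fun i => u (Sum.inl i)) (fun i => u (Sum.inr i)))) (k : ℕ) :
    JointlyDefinable L a b (fun v => GraphSubgroupLikeOn G P k (F v) (S v))
      (fun v => GraphSubgroupLikeOn G' P' k (F' v) (S' v)) := by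
  have hP' : ∀ {δ : Type _} (x y z : Fin n → δ), JointlyDefinable L a b
      (fun v : δ → M => P (fun t => v (x t)) (fun t => v (y t)) (fun t => v (z t)))
      (fun v => P' (fun t => v (x t)) (fun t => v (y t)) (fun t => v (z t))) :=
    fun x y z => hP.comp (fun q => ![x, y, z] q.1 q.2)
  unfold GraphSubgroupLikeOn
  refine .and ?_ ?_
  · refine .forall_curried (.forall_curried (.forall_curried ?_))
    refine .imp (hF.apply_curried _ _) (.imp (hF.apply_curried _ _) (.imp (hS.apply_curried _ _)
      (.imp (hS.apply_curried _ _) (.imp (hG.comp _) (.imp (hP' _ _ _) (hS.apply_curried _ _))))))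
  · refine .forall_family (.imp (.forall_index fun i => hF.apply_curried _ _)
      (.exists_index fun i => .exists_index fun i' => .and (.const _) (.exists_curried ?_)))
    exact .and (hG.comp _) (.and (hP' _ _ _) (hS.apply_curried _ _))

theorem mem_subgroupSet {X : Type*} {G : Set X} [Group G] {H : Subgroup G} (g : G) :
    (g : X) ∈ subgroupSet H ↔ g ∈ H :=
  ⟨fun ⟨_, hg', he⟩ => Subtype.ext he ▸ hg', fun hg => ⟨g, hg, rfl⟩⟩

theorem subgroupSet_subset {X : Type*} {G : Set X} [Group G] {H : Subgroup G} {x : X}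
    (hx : x ∈ subgroupSet H) : x ∈ G := by
  obtain ⟨g, -, rfl⟩ := hx
  exact g.2

namespace DefinableGroup

variable {A : Set M} {n : ℕ} (G : DefinableGroup L M A n)

theorem subgroupLikeOn_iff (j : M ↪ₑ[L] N) {k : ℕ} {F S : (Fin n → N) → Prop}
    (hF : ∀ x, F x → x ∈ G.points j) :
    SubgroupLikeOn k {g : G.points j | F g} (fun g => S g) ↔
      GraphSubgroupLikeOn (fun x => x ∈ G.points j) (relation G.mul j) k F S := by
  constructor
  · rintro ⟨h1, h2⟩
    refine ⟨fun x y z hx hy hSx hSy hz hP => ?_, fun a ha => ?_⟩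
    · have := h1 ⟨x, hF x hx⟩ hx ⟨y, hF y hy⟩ hy hSx hSy
      rwa [← eq_mul_inv_iff_mul_eq.2 ((G.mul_eq_iff j ⟨z, hz⟩ ⟨y, hF y hy⟩ ⟨x, hF x hx⟩).2 hP)]
        at this
    · obtain ⟨i, i', hii, hS⟩ := h2 (fun i => ⟨a i, hF _ (ha i)⟩) ha
      exact ⟨i, i', hii, _, Subtype.prop _, (G.mul_eq_iff j ⟨a i, hF _ (ha i)⟩ _
        ⟨a i', hF _ (ha i')⟩).1 (mul_inv_cancel_left _ _), hS⟩
  · rintro ⟨h1, h2⟩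
    refine ⟨fun x hx y hy hSx hSy => ?_, fun a ha => ?_⟩
    · exact h1 x y _ hx hy hSx hSy (Subtype.prop _)
        ((G.mul_eq_iff j _ y x).1 (inv_mul_cancel_right _ _))
    · obtain ⟨i, i', hii, z, hz, hP, hS⟩ := h2 (fun i => a i) ha
      refine ⟨i, i', hii, ?_⟩
      rwa [← eq_inv_mul_iff_mul_eq.2 ((G.mul_eq_iff j (a i) ⟨z, hz⟩ (a i')).2 hP)]

theorem subgroupLikeOn_univ_iff (j : M ↪ₑ[L] N) {k : ℕ} {S : (Fin n → N) → Prop} :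
    SubgroupLikeOn k Set.univ (fun g : G.points j => S g) ↔
      GraphSubgroupLikeOn (fun x => x ∈ G.points j) (relation G.mul j) k
        (fun x => x ∈ G.points j) S := by
  rw [← G.subgroupLikeOn_iff j (fun _ hx => hx)]
  have : {g : G.points j | (g : Fin n → N) ∈ G.points j} = Set.univ :=
    Set.eq_univ_of_forall fun g => g.2
  rw [this]

theorem jointlyDefinable_points (j : M ↪ₑ[L] N) :
    JointlyDefinable L (fun a : A => (a : M)) (fun a : A => j a)
      (fun v => v ∈ G.points (ElementaryEmbedding.refl L M)) (fun v => v ∈ G.points j) :=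
  ⟨G.carrier, fun _ => Iff.rfl, fun _ => Iff.rfl⟩

theorem jointlyDefinable_mul (j : M ↪ₑ[L] N) :
    JointlyDefinable L (fun a : A => (a : M)) (fun a : A => j a)
      (fun u : Fin 3 × Fin n → M => relation G.mul (ElementaryEmbedding.refl L M)
        (fun t => u (0, t)) (fun t => u (1, t)) (fun t => u (2, t)))
      (fun u => relation G.mul j (fun t => u (0, t)) (fun t => u (1, t)) (fun t => u (2, t))) := by
  refine ⟨G.mul, fun v => ?_, fun v => ?_⟩
  all_goals
    refine iff_of_eq (congrArg (fun x => Formula.Realize G.mul (Sum.elim _ x)) ?_)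
    funext ⟨i, t⟩
    fin_cases i <;> rfl

/-- A subgroup of finite index of `G(M)` that is externally definable is definable, by a formula
whose only parameters outside of `A` are the coordinates of the points `f₀` of
`exists_mem_iff_of_agree_on_finite`. -/
theorem exists_jointlyDefinable_mem_iff (hM : StructureNIP L M)
    (H : Subgroup (G.points (ElementaryEmbedding.refl L M))) (h0 : H.index ≠ 0)
    (hX : Approximable L (subgroupSet H)) :
    ∃ (γ : Type) (_ : Finite γ) (D : (γ → M) → (Fin n → M) → Prop) (m : γ → M),
      JointlyDefinable L (fun a : A => (a : M)) (fun a : A => (a : M))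
        (fun u : γ ⊕ Fin n → M => D (fun i => u (Sum.inl i)) (fun i => u (Sum.inr i)))
        (fun u => D (fun i => u (Sum.inl i)) (fun i => u (Sum.inr i))) ∧
      ∀ g : G.points (ElementaryEmbedding.refl L M), g ∈ H ↔ D m g := by
  obtain ⟨p, φ, hφ⟩ := hX.exists_formula
  have hVC : FiniteVC (fun (c : Fin p → M) (g : G.points (ElementaryEmbedding.refl L M)) =>
      φ.Realize (Sum.elim (g : Fin n → M) c)) := by
    obtain ⟨l, hl⟩ := hM.finiteVC (d := (Empty.elim : Empty → M)) (α := Fin p) (β := Fin n)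
      ((JointlyDefinable.of_parameterFree_formula φ).comp Sum.swap)
    refine ⟨l, fun a ha => hl a fun S => ?_⟩
    obtain ⟨g, hg⟩ := ha S
    refine ⟨g, fun i => Iff.trans (iff_of_eq (congrArg _ ?_)) (hg i)⟩
    funext k
    cases k <;> rfl
  obtain ⟨t, s, f₀, hf₀⟩ := exists_mem_iff_of_agree_on_finite
    (φ := fun (g : G.points (ElementaryEmbedding.refl L M)) (c : Fin p → M) =>
      φ.Realize (Sum.elim (g : Fin n → M) c)) hVC H h0 le_rfl (fun F hF => by
    obtain ⟨c, hc⟩ := hφ (Subtype.val '' F) (hF.image _)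
    exact ⟨c, fun x hx => (hc _ ⟨x, hx, rfl⟩).trans (mem_subgroupSet x)⟩)
  refine ⟨Fin t × Fin n, inferInstance, fun m g => ∃ f₁ : Fin s → Fin n → M,
    (∀ i, f₁ i ∈ G.points (ElementaryEmbedding.refl L M)) ∧ ∀ c : Fin p → M,
      GraphSubgroupLikeOn (fun x => x ∈ G.points (ElementaryEmbedding.refl L M))
        (relation G.mul (ElementaryEmbedding.refl L M)) H.index
        (fun x => ∃ i, ∀ e, x e = f₁ i e) (fun x => φ.Realize (Sum.elim x c)) →
      (∀ i, φ.Realize (Sum.elim (fun e => m (i, e)) c) ↔ f₀ i ∈ H) → φ.Realize (Sum.elim g c),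
    fun q => (f₀ q.1 : Fin n → M) q.2, ?_, fun g => ?_⟩
  · have hpts := (G.jointlyDefinable_points (ElementaryEmbedding.refl L M)).left
    have hφ' : ∀ {δ : Type} (x : Fin n → δ) (c : Fin p → δ), JointlyDefinable L
        (fun a : A => (a : M)) (fun a : A => (a : M))
        (fun v : δ → M => φ.Realize (Sum.elim (fun i => v (x i)) (fun i => v (c i))))
        (fun v => φ.Realize (Sum.elim (fun i => v (x i)) (fun i => v (c i)))) := by
      intro δ x c
      refine ((JointlyDefinable.of_parameterFree_formula φ).comp (Sum.elim x c)).congr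
        (fun v => ?_) (fun v => ?_)
      all_goals
        refine iff_of_eq (congrArg _ ?_)
        funext k
        cases k <;> rfl
    refine .exists_family (.and (.forall_index fun i => hpts.comp _) (.forall_curried
      (.imp ?_ (.imp (.forall_index fun i => .iff (hφ' _ _) (.const _)) (hφ' _ _)))))
    refine JointlyDefinable.graphSubgroupLikeOn hpts
      (G.jointlyDefinable_mul (ElementaryEmbedding.refl L M)).left
      (F := fun v x => ∃ i : Fin s, ∀ e, x e = v (Sum.inl (Sum.inr (i, e))))
      (F' := fun v x => ∃ i : Fin s, ∀ e, x e = v (Sum.inl (Sum.inr (i, e))))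
      (S := fun v x => φ.Realize (Sum.elim x (fun i => v (Sum.inr i))))
      (S' := fun v x => φ.Realize (Sum.elim x (fun i => v (Sum.inr i)))) ?_ (hφ' _ _) _
    exact .exists_index fun i => .forall_index fun e => .eq_var _ _
  · have hsub : ∀ (f₁ : Fin s → G.points (ElementaryEmbedding.refl L M)) (c : Fin p → M),
        SubgroupLikeOn H.index (Set.range f₁) (fun x => φ.Realize (Sum.elim (x : Fin n → M) c)) ↔
        GraphSubgroupLikeOn (fun x => x ∈ G.points (ElementaryEmbedding.refl L M))
        (relation G.mul (ElementaryEmbedding.refl L M)) H.index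
        (fun x => ∃ i, ∀ e, x e = (f₁ i : Fin n → M) e) (fun x => φ.Realize (Sum.elim x c)) := by
      intro f₁ c
      rw [← G.subgroupLikeOn_iff (ElementaryEmbedding.refl L M)
        (F := fun x => ∃ i, ∀ e, x e = (f₁ i : Fin n → M) e)
        (S := fun x => φ.Realize (Sum.elim x c))]
      · refine iff_of_eq (congrArg (fun F => SubgroupLikeOn H.index F _) ?_)
        ext x
        constructor
        · rintro ⟨i, rfl⟩
          exact ⟨i, fun _ => rfl⟩
        · rintro ⟨i, hi⟩
          exact ⟨i, (Subtype.ext (funext hi)).symm⟩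
      · rintro x ⟨i, hi⟩
        rw [show x = f₁ i from funext hi]
        exact (f₁ i).2
    rw [hf₀]
    constructor
    · rintro ⟨f₁, h⟩
      exact ⟨fun i => f₁ i, fun i => (f₁ i).2, fun c hc => h c ((hsub f₁ c).2 hc)⟩
    · rintro ⟨f₁, hf₁, h⟩
      exact ⟨fun i => ⟨f₁ i, hf₁ i⟩, fun c hc => h c ((hsub _ c).1 hc)⟩

/-- If a subgroup of finite index of `G(M)` belongs to a family that is definable over `A`, then
the intersection of all subgroups in the family of at most the same index is definable over `A`,
and by the Baldwin-Saxl lemma it is of finite index. -/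
theorem exists_formula_le (hM : StructureNIP L M)
    {H : Subgroup (G.points (ElementaryEmbedding.refl L M))} (h0 : H.index ≠ 0)
    {γ : Type} [Finite γ] {D : (γ → M) → (Fin n → M) → Prop} {m : γ → M}
    (hD : JointlyDefinable L (fun a : A => (a : M)) (fun a : A => (a : M))
        (fun u : γ ⊕ Fin n → M => D (fun i => u (Sum.inl i)) (fun i => u (Sum.inr i)))
        (fun u => D (fun i => u (Sum.inl i)) (fun i => u (Sum.inr i))))
    (hH : ∀ g : G.points (ElementaryEmbedding.refl L M), g ∈ H ↔ D m g) :
    ∃ (χ : L.Formula (A ⊕ Fin n)) (K : Subgroup (G.points (ElementaryEmbedding.refl L M))),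
      K ≤ H ∧ K.index ≠ 0 ∧
        ∀ x, χ.Realize (Sum.elim (fun a : A => (a : M)) x) ↔ x ∈ subgroupSet K := by
  let ι := {d : γ → M // SubgroupLikeOn H.index Set.univ
    (fun g : G.points (ElementaryEmbedding.refl L M) => D d g)}
  choose K hK hK0 hKk using fun d : ι => d.2.exists_subgroup
  obtain ⟨l, hl⟩ := hM.finiteVC hD
  obtain ⟨-, -, hne, -⟩ := exists_finset_iInf_eq K (l := l) (fun a ha => hl (fun i => (a i).1)
    fun S => by
      obtain ⟨g, hg⟩ := ha S
      exact ⟨g, fun i => (hK (a i) g).symm.trans (hg i)⟩) (Nat.one_le_iff_ne_zero.2 h0) hK0 hKk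
  have hpts := (G.jointlyDefinable_points (ElementaryEmbedding.refl L M)).left
  obtain ⟨χ, hχ, -⟩ : JointlyDefinable L (fun a : A => (a : M)) (fun a : A => (a : M))
      (fun x : Fin n → M => x ∈ G.points (ElementaryEmbedding.refl L M) ∧ ∀ d : γ → M,
        GraphSubgroupLikeOn (fun x => x ∈ G.points (ElementaryEmbedding.refl L M))
          (relation G.mul (ElementaryEmbedding.refl L M)) H.index
          (fun x => x ∈ G.points (ElementaryEmbedding.refl L M)) (D d) → D d x)
      (fun x : Fin n → M => x ∈ G.points (ElementaryEmbedding.refl L M) ∧ ∀ d : γ → M,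
        GraphSubgroupLikeOn (fun x => x ∈ G.points (ElementaryEmbedding.refl L M))
          (relation G.mul (ElementaryEmbedding.refl L M)) H.index
          (fun x => x ∈ G.points (ElementaryEmbedding.refl L M)) (D d) → D d x) :=
    .and hpts (.forall_curried (.imp (.graphSubgroupLikeOn hpts
      (G.jointlyDefinable_mul (ElementaryEmbedding.refl L M)).left
      (F := fun _ x => x ∈ G.points (ElementaryEmbedding.refl L M))
      (F' := fun _ x => x ∈ G.points (ElementaryEmbedding.refl L M))
      (S := fun v => D (fun i => v (Sum.inr i))) (S' := fun v => D (fun i => v (Sum.inr i)))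
      (hpts.comp _) (hD.apply_curried _ _) _) (hD.apply_curried _ _)))
  refine ⟨χ, ⨅ i, K i, ?_, hne, fun x => (hχ x).trans ?_⟩
  · have hm : SubgroupLikeOn H.index Set.univ
        (fun g : G.points (ElementaryEmbedding.refl L M) => D m g) := by
      simpa only [hH] using SubgroupLikeOn.of_subgroup H h0 le_rfl Set.univ
    refine (iInf_le K ⟨m, hm⟩).trans fun g hg => ?_
    rw [hH]
    exact (hK ⟨m, hm⟩ g).1 hg
  · constructor
    · rintro ⟨hx, h⟩
      refine (mem_subgroupSet ⟨x, hx⟩).2 ((Subgroup.mem_iInf).2 fun d => (hK d _).2 ?_)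
      exact h d.1 ((G.subgroupLikeOn_univ_iff (ElementaryEmbedding.refl L M)).1 d.2)
    · intro hx
      have hxG := subgroupSet_subset hx
      have hx' := Subgroup.mem_iInf.1 ((mem_subgroupSet ⟨x, hxG⟩).1 hx)
      refine ⟨hxG, fun d hd => ?_⟩
      have hd' := (G.subgroupLikeOn_univ_iff (ElementaryEmbedding.refl L M)).2 hd
      exact (hK ⟨d, hd'⟩ _).1 (hx' ⟨d, hd'⟩)

/-- The subgroups of index at most `k` of `G(M)` that are defined by instances of a formula of
the language of Shelah's expansion all contain one subgroup of finite index that is definable over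
`A` by a formula of `L`. -/
theorem exists_formula_forall_le (hM : StructureNIP L M) {p : ℕ}
    (ψ : (extLanguage L M).Formula (Fin p ⊕ Fin n)) {k : ℕ} (hk : 1 ≤ k) :
    ∃ (χ : L.Formula (A ⊕ Fin n)) (K : Subgroup (G.points (ElementaryEmbedding.refl L M))),
      K.index ≠ 0 ∧ (∀ x, χ.Realize (Sum.elim (fun a : A => (a : M)) x) ↔ x ∈ subgroupSet K) ∧
      ∀ y : Fin p → M, SubgroupLikeOn k Set.univ
        (fun g : G.points (ElementaryEmbedding.refl L M) => ψ.Realize (Sum.elim y g)) →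
        ∀ g ∈ K, ψ.Realize (Sum.elim y g) := by
  let ι := {y : Fin p → M // SubgroupLikeOn k Set.univ
    (fun g : G.points (ElementaryEmbedding.refl L M) => ψ.Realize (Sum.elim y g))}
  choose K hK hK0 hKk using fun y : ι => y.2.exists_subgroup
  have hψ := approximable_extLanguage_formula hM ψ
  obtain ⟨l, hl⟩ := hψ.finiteVC hM
  obtain ⟨s, hs, hne, -⟩ := exists_finset_iInf_eq K (l := l) (fun a ha => hl (fun i => (a i).1)
    fun S => by
      obtain ⟨g, hg⟩ := ha S
      exact ⟨g, fun i => (hK (a i) g).symm.trans (hg i)⟩) hk hK0 hKk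
  have hX : Approximable L (subgroupSet (⨅ i, K i)) := by
    have h := (Approximable.of_paramDefinable ((G.jointlyDefinable_points
      (ElementaryEmbedding.refl L M)).left.definable (A := A) fun a => a.2).paramDefinable).and
      (Approximable.forall_mem_finset s fun y _ => hψ.fix_left y.1)
    convert h using 1
    ext x
    constructor
    · intro hx
      have hxG := subgroupSet_subset hx
      have hx' := Subgroup.mem_iInf.1 ((mem_subgroupSet ⟨x, hxG⟩).1 hx)
      exact ⟨hxG, fun i _ => (hK i _).1 (hx' i)⟩
    · rintro ⟨hxG, hx⟩
      refine (mem_subgroupSet (⟨x, hxG⟩ : G.points (ElementaryEmbedding.refl L M))).2 ?_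
      rw [hs]
      simp only [Subgroup.mem_iInf]
      exact fun i hi => (hK i _).2 (hx i hi)
  obtain ⟨γ, hγ, D, m, hD, hH⟩ := G.exists_jointlyDefinable_mem_iff hM _ hne hX
  obtain ⟨χ, K', hK', hne', hχ⟩ := G.exists_formula_le hM hne hD hH
  exact ⟨χ, K', hne', hχ, fun y hy g hg =>
    (hK ⟨y, hy⟩ g).1 (Subgroup.mem_iInf.1 (hK' hg) ⟨y, hy⟩)⟩

end DefinableGroup

end

end NIPGroup

namespace NIPGroup

/-! ### Connected components in elementary extensions of Shelah's expansion -/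

section

variable {L : FirstOrder.Language.{u, v}} {M : Type w} [L.Structure M]

theorem externallyDefinable_of_formula {A : Set M} {n : ℕ} (χ : L.Formula (A ⊕ Fin n)) :
    ExternallyDefinable L {x : Fin n → M | χ.Realize (Sum.elim (fun a : A => (a : M)) x)} := by
  let e : M ≃ ULift.{max u v} M := Equiv.ulift.symm
  let _ : L.Structure (ULift.{max u v} M) := e.inducedStructure
  let j : M ↪ₑ[L] ULift.{max u v} M := (e.inducedStructureEquiv (L := L)).toElementaryEmbedding
  refine ⟨ULift.{max u v} M, inferInstance, j, {x | χ.Realize (Sum.elim (fun a : A => j a) x)},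
    (JointlyDefinable.of_formula (b := fun a : A => j a) χ).left.definable
      fun _ => Set.mem_univ _, ?_⟩
  ext x
  exact (JointlyDefinable.elementary_iff j (JointlyDefinable.of_formula χ) x).symm

variable {A : Set M} {n : ℕ} (G : DefinableGroup L M A n)

/-- In an elementary extension `N` of Shelah's expansion, every subgroup of finite index of `G(N)`
that is definable in the expanded language contains a subgroup of finite index that is
definable over `A` in the original language and without parameters in the expanded one. -/
theorem exists_le_definable_of_definable_extLanguage (hM : StructureNIP L M) {N : Type w'}
    [L.Structure N] [(extLanguage L M).Structure N]
    [(LHom.sumInl : L →ᴸ extLanguage L M).IsExpansionOn N] (j : M ↪ₑ[extLanguage L M] N)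
    (H : Subgroup (G.points (reduct (LHom.sumInl : L →ᴸ extLanguage L M) j)))
    (hH0 : H.FiniteIndex) {B : Set N} (hH : B.Definable (extLanguage L M) (subgroupSet H)) :
    ∃ K : Subgroup (G.points (reduct (LHom.sumInl : L →ᴸ extLanguage L M) j)), K ≤ H ∧
      K.FiniteIndex ∧ (j '' A).Definable L (subgroupSet K) ∧
      (∅ : Set N).Definable (extLanguage L M) (subgroupSet K) := by
  let F : L →ᴸ extLanguage L M := LHom.sumInl
  obtain ⟨p, c, ψ, hψ⟩ := hH.paramDefinable.exists_finite_parameters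
  have hψ' : ∀ x : Fin n → N, (ψ.relabel Sum.swap).Realize (Sum.elim c x) ↔ x ∈ subgroupSet H :=
    fun x => by
      rw [← hψ, Formula.realize_relabel]
      refine iff_of_eq (congrArg _ ?_)
      funext k
      cases k <;> rfl
  obtain ⟨χ, K, hK0, hχ, hK⟩ := G.exists_formula_forall_le hM (ψ.relabel Sum.swap)
    (k := H.index) (Nat.one_le_iff_ne_zero.2 hH0.index_ne_zero)
  have hpts := G.jointlyDefinable_points (reduct F j)
  have hmul := G.jointlyDefinable_mul (reduct F j)
  have hχj : JointlyDefinable L (fun a : A => (a : M)) (fun a : A => (reduct F j) a)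
      (fun x : Fin n → M => χ.Realize (Sum.elim (fun a : A => (a : M)) x))
      (fun x : Fin n → N => χ.Realize (Sum.elim (fun a : A => (reduct F j) a) x)) :=
    .of_formula χ
  -- `χ` defines a subgroup of finite index of `G(N)`
  have hχpts : ∀ x : Fin n → N, χ.Realize (Sum.elim (fun a : A => (reduct F j) a) x) →
      x ∈ G.points (reduct F j) :=
    (hχj.imp hpts).transfer (reduct F j) fun x hx => subgroupSet_subset ((hχ x).1 hx)
  have hχsub : GraphSubgroupLikeOn (fun x => x ∈ G.points (reduct F j))
      (relation G.mul (reduct F j)) K.index (fun x => x ∈ G.points (reduct F j))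
      (fun x => χ.Realize (Sum.elim (fun a : A => (reduct F j) a) x)) := by
    refine (JointlyDefinable.graphSubgroupLikeOn (α := Fin 0) hpts hmul
      (F := fun _ x => x ∈ G.points (ElementaryEmbedding.refl L M))
      (F' := fun _ x => x ∈ G.points (reduct F j))
      (S := fun _ x => χ.Realize (Sum.elim (fun a : A => (a : M)) x))
      (S' := fun _ x => χ.Realize (Sum.elim (fun a : A => (reduct F j) a) x))
      (hpts.comp _) (hχj.comp _) K.index).transfer (reduct F j) (fun _ => ?_) Fin.elim0
    rw [← G.subgroupLikeOn_univ_iff (ElementaryEmbedding.refl L M)]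
    simpa only [hχ, mem_subgroupSet] using SubgroupLikeOn.of_subgroup K hK0 le_rfl Set.univ
  obtain ⟨K', hK', hK'0, -⟩ :=
    ((G.subgroupLikeOn_univ_iff (reduct F j)).2 hχsub).exists_subgroup
  have hset : subgroupSet K' =
      {x | χ.Realize (Sum.elim (fun a : A => (reduct F j) a) x)} := by
    ext x
    constructor
    · rintro ⟨g, hg, rfl⟩
      exact (hK' g).1 hg
    · intro hx
      exact ⟨⟨x, hχpts x hx⟩, (hK' _).2 hx, rfl⟩
  refine ⟨K', fun g hg => ?_, ⟨hK'0⟩, ?_, ?_⟩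
  · -- that `χ` lies below all subgroups defined by `ψ` is expressed by a formula
    have hψj : JointlyDefinable (extLanguage L M) (fun a : A => (a : M)) (fun a : A => j a)
        (fun u : Fin p ⊕ Fin n → M => (ψ.relabel Sum.swap).Realize
          (Sum.elim (fun i => u (Sum.inl i)) (fun i => u (Sum.inr i))))
        (fun u => (ψ.relabel Sum.swap).Realize
          (Sum.elim (fun i => u (Sum.inl i)) (fun i => u (Sum.inr i)))) := by
      refine (JointlyDefinable.of_parameterFree_formula (ψ.relabel Sum.swap)).congr
        (fun u => ?_) (fun u => ?_)
      all_goals exact iff_of_eq (congrArg _ (Sum.elim_comp_inl_inr u).symm)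
    have hall : JointlyDefinable (extLanguage L M) (fun a : A => (a : M)) (fun a : A => j a)
        (fun y : Fin p → M => ∀ x : Fin n → M,
          χ.Realize (Sum.elim (fun a : A => (a : M)) x) →
            (ψ.relabel Sum.swap).Realize (Sum.elim y x))
        (fun y => ∀ x : Fin n → N, χ.Realize (Sum.elim (fun a : A => (reduct F j) a) x) →
            (ψ.relabel Sum.swap).Realize (Sum.elim y x)) :=
      .forall_curried (((hχj.map_language F).comp Sum.inr).imp hψj)
    have key := (JointlyDefinable.imp (JointlyDefinable.graphSubgroupLikeOn (α := Fin p)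
      (hpts.map_language F) (hmul.map_language F)
      (F := fun _ x => x ∈ G.points (ElementaryEmbedding.refl L M))
      (F' := fun _ x => x ∈ G.points (reduct F j))
      (S := fun y x => (ψ.relabel Sum.swap).Realize (Sum.elim y x))
      (S' := fun y x => (ψ.relabel Sum.swap).Realize (Sum.elim y x))
      ((hpts.map_language F).comp _) hψj H.index)
      hall).transfer j
      (fun y hy x hx => by
        have hx' := (hχ x).1 hx
        exact hK y ((G.subgroupLikeOn_univ_iff (ElementaryEmbedding.refl L M)).2 hy)
          ⟨x, subgroupSet_subset hx'⟩ ((mem_subgroupSet ⟨x, subgroupSet_subset hx'⟩).1 hx')) c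
    rw [← mem_subgroupSet, ← hψ']
    refine key ?_ g ((hK' g).1 hg)
    rw [← G.subgroupLikeOn_univ_iff (reduct F j)]
    simpa only [hψ', mem_subgroupSet] using
      SubgroupLikeOn.of_subgroup H hH0.index_ne_zero le_rfl Set.univ
  · rw [hset]
    exact hχj.right.definable fun a => ⟨a, a.2, rfl⟩
  · -- the set defined by `χ` in `M` is named by a predicate of the expanded language
    let R : (extLanguage L M).Relations n :=
      Sum.inr ⟨{x | χ.Realize (Sum.elim (fun a : A => (a : M)) x)},
        externallyDefinable_of_formula χ⟩
    have hR : JointlyDefinable (extLanguage L M) (Empty.elim : Empty → M)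
        (Empty.elim : Empty → N) (fun x : Fin n → M => (R.formula Term.var).Realize x)
        (fun x : Fin n → N => (R.formula Term.var).Realize x) :=
      .of_parameterFree_formula _
    have hRA : JointlyDefinable (extLanguage L M) (fun a : A => (a : M)) (fun a : A => j a)
        (fun x : Fin n → M => (R.formula Term.var).Realize x)
        (fun x : Fin n → N => (R.formula Term.var).Realize x) :=
      .of_parameterFree_formula _
    have key := (hRA.iff (hχj.map_language F)).transfer j (fun x => by
      rw [Formula.realize_rel]
      rfl)
    rw [hset]
    exact (hR.right.congr key key).definable fun k => k.elim

theorem ExternallyDefinable.definable_of_finiteIndex (hM : StructureNIP L M)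
    (H : Subgroup (G.points (ElementaryEmbedding.refl L M))) (hH : H.FiniteIndex)
    (hX : ExternallyDefinable L (subgroupSet H)) :
    (Set.univ : Set M).Definable L (subgroupSet H) := by
  obtain ⟨γ, _, D, m, hD, hDH⟩ :=
    G.exists_jointlyDefinable_mem_iff hM H hH.index_ne_zero hX.approximable
  have hD' : ParamDefinable L
      (fun u : γ ⊕ Fin n → M => D (fun i => u (Sum.inl i)) (fun i => u (Sum.inr i))) :=
    (hD.definable (A := Set.univ) fun _ => Set.mem_univ _).paramDefinable
  have h := ((G.jointlyDefinable_points (ElementaryEmbedding.refl L M)).left.definable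
    (A := Set.univ) fun _ => Set.mem_univ _).inter
      (ParamDefinable.fix_right (hD'.comp Sum.swap) m).definable
  convert h using 1
  ext x
  constructor
  · rintro ⟨g, hg, rfl⟩
    exact ⟨g.2, (hDH g).1 hg⟩
  · rintro ⟨hx, hDx⟩
    exact ⟨⟨x, hx⟩, (hDH _).2 hDx, rfl⟩

theorem connectedComponent_eq (hM : StructureNIP L M) {N : Type w'}
    [L.Structure N] [(extLanguage L M).Structure N]
    [(LHom.sumInl : L →ᴸ extLanguage L M).IsExpansionOn N] (j : M ↪ₑ[extLanguage L M] N)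
    {B : Set N} (B' : Set N) (hB : j '' A ⊆ B) :
    connectedComponent L B (G.points (reduct (LHom.sumInl : L →ᴸ extLanguage L M) j)) =
      connectedComponent (extLanguage L M) B'
        (G.points (reduct (LHom.sumInl : L →ᴸ extLanguage L M) j)) := by
  refine le_antisymm (le_sInf fun H hH => ?_) (le_sInf fun H hH => ?_)
  · obtain ⟨K, hKH, hK0, hK, -⟩ :=
      exists_le_definable_of_definable_extLanguage G hM j H hH.1 hH.2
    have hmem : K ∈ {H | H.FiniteIndex ∧ B.Definable L (subgroupSet H)} := ⟨hK0, hK.mono hB⟩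
    exact (sInf_le hmem).trans hKH
  · obtain ⟨K, hKH, hK0, -, hK⟩ := exists_le_definable_of_definable_extLanguage G hM j H hH.1
      (hH.2.map_expansion (LHom.sumInl : L →ᴸ extLanguage L M))
    have hmem : K ∈ {H | H.FiniteIndex ∧ B'.Definable (extLanguage L M) (subgroupSet H)} :=
      ⟨hK0, hK.mono (Set.empty_subset _)⟩
    exact (sInf_le hmem).trans hKH

end

end NIPGroup

theorem mainTheorem5 {L : FirstOrder.Language.{u, v}} (T : L.Theory) (hT : T.IsComplete)
    (hNIP : NIPGroup.TheoryNIP.{u, v, w} T) (M : Type w) [L.Structure M] [Nonempty M] [M ⊨ T]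
    (A : Set M) (n : ℕ) (G : NIPGroup.DefinableGroup L M A n) :
    -- every externally definable subgroup of finite index of `G(M)` is `M`-definable
    (∀ H : Subgroup (G.points (ElementaryEmbedding.refl L M)), H.FiniteIndex →
      NIPGroup.ExternallyDefinable L (NIPGroup.subgroupSet H) →
      (Set.univ : Set M).Definable L (NIPGroup.subgroupSet H)) ∧
    -- `G⁰(M)` is the same in `M` and in Shelah's expansion of `M`
    (∀ B B' : Set M, A ⊆ B →
      NIPGroup.connectedComponent L B (G.points (ElementaryEmbedding.refl L M)) =
        NIPGroup.connectedComponent (NIPGroup.extLanguage L M) B'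
          (G.points (ElementaryEmbedding.refl L M))) ∧
    -- the same in every elementary extension `N` of Shelah's expansion, such as a monster model
    (∀ (N : Type w') [L.Structure N] [(NIPGroup.extLanguage L M).Structure N]
      [(LHom.sumInl : L →ᴸ NIPGroup.extLanguage L M).IsExpansionOn N]
      (j : M ↪ₑ[NIPGroup.extLanguage L M] N) (B B' : Set N), j '' A ⊆ B →
      NIPGroup.connectedComponent L B
          (G.points (NIPGroup.reduct (LHom.sumInl : L →ᴸ NIPGroup.extLanguage L M) j)) =
        NIPGroup.connectedComponent (NIPGroup.extLanguage L M) B'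
          (G.points (NIPGroup.reduct (LHom.sumInl : L →ᴸ NIPGroup.extLanguage L M) j))) := by
  have hM : NIPGroup.StructureNIP L M := fun m n φ => hNIP (Theory.ModelType.of T M) m n φ
  refine ⟨NIPGroup.ExternallyDefinable.definable_of_finiteIndex G hM, fun B B' hB => ?_, fun N _ _ _ j B B' hB =>
    NIPGroup.connectedComponent_eq G hM j B' hB⟩
  · exact NIPGroup.connectedComponent_eq G hM (ElementaryEmbedding.refl (NIPGroup.extLanguage L M) M)
      B' (by rintro _ ⟨a, ha, rfl⟩; exact hB ha)
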